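/- **Lemma 5.4.** Let $\mathbb T=\mathbb R/\mathbb Z$, identified with $[0,1)$, let $L^2(\mathbb T)$ be the real Hilbert space, and fix $\epsilon>0$, $q>1$, $0<t_0<\tfrac12$, $1<p_0<\infty$. *Limit law.* Let $D_q=D+\epsilon^qP:H^1(\mathbb T)\to L^2(\mathbb T)$, where $D$ is the weak derivative and $Pf=\big(\int_{\mathbb T}f\big)\mathbf 1$. It is bijective; let $L=D_q^{-1}:L^2(\mathbb T)\to L^2(\mathbb T)$. For $v\in L^2(\mathbb T)$ let $\Lambda(v)$ be multiplication by $(\epsilon^2+v^2)^{-1}$ and let $\lambda^v$ be the centred Gaussian measure on $L^2(\mathbb T)$ with covariance operator $C_U(v)=L\Lambda(v)L^*$. *Discretized law.* Let $N=2^n$, $K_j^N=[(j-1)/N,j/N)$ for $1\le j\le N$, and let $PL(n)$ be the space of continuous functions on $\mathbb T$ that are linear (affine) on each $K^N_j$. Let $(f_j)_{j\ge1}\subset H^1(\mathbb T)$ be orthonormal for the inner product $\langle D_qf,D_qg\rangle_{L^2}$ and such that, for each $n\ge1$, $f_1,\dots,f_N$ span $PL(n)$. Put $Q_nv=N\sum_{j=1}^N\big(\int_{K_j^N}v\big)\mathbf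 1_{K_j^N}$ and let $\Lambda_n(v)$ be multiplication by $(\epsilon^2+(Q_nv)^2)^{-1}$. Let $\lambda_n^v$ be the law on $L^2(\mathbb T)$ of $\sum_{j=1}^N\mathbf U_jf_j$, where $\mathbf U=\mathbf C^{1/2}\mathbf W$, $\mathbf C_{jk}=\langle\Lambda_n(v)D_qf_j,D_qf_k\rangle_{L^2}$ and $\mathbf W$ is a standard Gaussian vector in $\mathbb R^N$. *Claim.* Let $W^{t_0,p_0}(\mathbb T)$ carry the norm given by $$\|w\|_{W^{t_0,p_0}}^{p_0}=\int_{\mathbb T}|w|^{p_0}\,dx+\int_{\mathbb T}\int_{\mathbb T}\frac{|w(x)-w(y)|^{p_0}}{|x-y|^{1+t_0p_0}}\,dx\,dy,$$ where $|x-y|$ is the distance on $\mathbb T$. Let $v\in L^2(\mathbb T)\cap W^{t_0,p_0}(\mathbb T)$, let $v_n\in PL(n)$ for $n\ge1$, and suppose $v_n\to v$ in $W^{t_0,p_0}(\mathbb T)$. Then $\lambda^v$ exists and is unique, and $\lambda_n^{v_n}$ converges weakly to $\lambda^v$ on $L^2(\mathbb T)$, that is, $\int g\,d\lambda_n^{v_n}\to\int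 g\,d\lambda^v$ for every bounded continuous $g:L^2(\mathbb T)\to\mathbb R$. -/

import Mathlib

open MeasureTheory ProbabilityTheory Set Filter Topology
open scoped ENNReal NNReal ContDiff

noncomputable section

namespace HierPrior

/-- The real Hilbert space `L²(𝕋)` on the circle `𝕋 = ℝ / ℤ` with Lebesgue measure. -/
abbrev L2T : Type := Lp ℝ 2 (volume : Measure UnitAddCircle)

instance instMeasurableSpaceL2T : MeasurableSpace L2T := borel L2T

instance instBorelSpaceL2T : BorelSpace L2T := ⟨rfl⟩

/-! ### The weak derivative, `H¹(𝕋)` and the perturbed derivative -/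

/-- `g` is the weak derivative of `f` on the circle: `∫ f φ' = - ∫ g φ` for every smooth
`1`-periodic test function `φ`. -/
def HasWeakDeriv (f g : L2T) : Prop :=
  ∀ φ : ℝ → ℝ, ContDiff ℝ ∞ φ → Function.Periodic φ 1 →
    ∫ x in (0 : ℝ)..1, f (x : UnitAddCircle) * deriv φ x =
      -∫ x in (0 : ℝ)..1, g (x : UnitAddCircle) * φ x

theorem pair_eq_inner (ψ : C(UnitAddCircle, ℝ)) (f : L2T) :
    ∫ x in (0 : ℝ)..1, f (x : UnitAddCircle) * ψ (x : UnitAddCircle) =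
      inner ℝ (ContinuousMap.toLp 2 volume ℝ ψ) f := by
  rw [L2.inner_def]
  have h := UnitAddCircle.intervalIntegral_preimage 0 (fun x : UnitAddCircle => f x * ψ x)
  rw [zero_add] at h
  rw [h]
  refine integral_congr_ae ?_
  filter_upwards [ContinuousMap.coeFn_toLp (E := ℝ) (p := 2) (𝕜 := ℝ)
    (volume : Measure UnitAddCircle) ψ] with x hx
  rw [hx]
  simp

/-- A continuous `1`-periodic function as a continuous function on the circle. -/
def perLift (φ : ℝ → ℝ) (hc : Continuous φ) (hp : Function.Periodic φ 1) :
    C(UnitAddCircle, ℝ) :=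
  ⟨hp.lift, continuous_quot_lift _ hc⟩

theorem perLift_coe (φ : ℝ → ℝ) (hc : Continuous φ) (hp : Function.Periodic φ 1) (x : ℝ) :
    perLift φ hc hp (x : UnitAddCircle) = φ x := rfl

theorem pair_per_eq_inner (φ : ℝ → ℝ) (hc : Continuous φ) (hp : Function.Periodic φ 1)
    (f : L2T) :
    ∫ x in (0 : ℝ)..1, f (x : UnitAddCircle) * φ x =
      inner ℝ (ContinuousMap.toLp 2 volume ℝ (perLift φ hc hp)) f :=
  pair_eq_inner (perLift φ hc hp) f

theorem periodic_deriv {φ : ℝ → ℝ} (hp : Function.Periodic φ 1) :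
    Function.Periodic (deriv φ) 1 := by
  intro x
  have : (fun y => φ (y + 1)) = φ := funext hp
  rw [← deriv_comp_add_const φ 1 x, this]

theorem hasWeakDeriv_iff (f g : L2T) : HasWeakDeriv f g ↔
    ∀ (φ : ℝ → ℝ) (h : ContDiff ℝ ∞ φ) (hp : Function.Periodic φ 1),
      inner ℝ (ContinuousMap.toLp 2 (volume : Measure UnitAddCircle) ℝ
          (perLift (deriv φ) (h.continuous_deriv (by norm_num)) (periodic_deriv hp))) f +
        inner ℝ (ContinuousMap.toLp 2 (volume : Measure UnitAddCircle) ℝ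
          (perLift φ h.continuous hp)) g = 0 := by
  refine forall_congr' fun φ => forall_congr' fun h => forall_congr' fun hp => ?_
  rw [pair_per_eq_inner (deriv φ) (h.continuous_deriv (by norm_num)) (periodic_deriv hp),
    pair_per_eq_inner φ h.continuous hp, eq_neg_iff_add_eq_zero]

theorem HasWeakDeriv.add {f g f' g' : L2T} (h : HasWeakDeriv f g) (h' : HasWeakDeriv f' g') :
    HasWeakDeriv (f + f') (g + g') := by
  rw [hasWeakDeriv_iff] at *
  intro φ hφ hp
  rw [inner_add_right, inner_add_right]
  linarith [h φ hφ hp, h' φ hφ hp]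

theorem HasWeakDeriv.smul {f g : L2T} (c : ℝ) (h : HasWeakDeriv f g) :
    HasWeakDeriv (c • f) (c • g) := by
  rw [hasWeakDeriv_iff] at *
  intro φ hφ hp
  rw [inner_smul_right, inner_smul_right, ← mul_add, h φ hφ hp, mul_zero]

theorem HasWeakDeriv.zero : HasWeakDeriv 0 0 := by
  rw [hasWeakDeriv_iff]
  intro φ hφ hp
  simp

theorem integral_toLp_mul (F : ℝ → ℝ) (hF : Continuous F) (hFp : Function.Periodic F 1)
    (φ : ℝ → ℝ) :
    ∫ x in (0 : ℝ)..1, (ContinuousMap.toLp 2 (volume : Measure UnitAddCircle) ℝ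
      (perLift F hF hFp)) (x : UnitAddCircle) * φ x = ∫ x in (0 : ℝ)..1, F x * φ x := by
  have hq := (UnitAddCircle.measurePreserving_mk 0).quasiMeasurePreserving.ae_eq_comp
    (ContinuousMap.coeFn_toLp (E := ℝ) (p := 2) (𝕜 := ℝ) (volume : Measure UnitAddCircle)
      (perLift F hF hFp))
  rw [zero_add] at hq
  rw [intervalIntegral.integral_of_le zero_le_one, intervalIntegral.integral_of_le zero_le_one]
  refine integral_congr_ae ?_
  filter_upwards [hq] with x hx
  simp only [Function.comp_apply] at hx
  rw [hx, perLift_coe]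

theorem memLp_coe (f : L2T) :
    MemLp (fun x : ℝ => f (x : UnitAddCircle)) 2 (volume.restrict (Ioc (0 : ℝ) 1)) := by
  have h := (Lp.memLp f).comp_measurePreserving (UnitAddCircle.measurePreserving_mk 0)
  rwa [zero_add] at h

theorem intervalIntegrable_coe (f : L2T) :
    IntervalIntegrable (fun x : ℝ => f (x : UnitAddCircle)) volume 0 1 := by
  rw [intervalIntegrable_iff_integrableOn_Ioc_of_le zero_le_one]
  exact (memLp_coe f).integrable (by norm_num)

theorem eq_zero_of_forall_pair (f : L2T)
    (h : ∀ φ : ℝ → ℝ, ContDiff ℝ ∞ φ → Function.Periodic φ 1 →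
      ∫ x in (0 : ℝ)..1, f (x : UnitAddCircle) * φ x = 0) : f = 0 := by
  have hm : MemLp (fun x => ((f x : ℝ) : ℂ)) 2 (AddCircle.haarAddCircle (T := 1)) :=
    (Lp.memLp f).ofReal.haarAddCircle
  have hint : ∀ φ : ℝ → ℝ, Continuous φ →
      IntervalIntegrable (fun x : ℝ => f (x : UnitAddCircle) * φ x) volume 0 1 :=
    fun φ hφ => (intervalIntegrable_coe f).mul_continuousOn hφ.continuousOn
  have hz : hm.toLp _ = 0 := by
    apply (fourierBasis (T := 1)).repr.injective
    ext i
    rw [fourierBasis_repr, map_zero, fourierCoeff_congr_ae hm.coeFn_toLp,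
      fourierCoeff_eq_intervalIntegral _ _ 0]
    have e : ∀ x : ℝ, (fourier (-i) (x : UnitAddCircle) • ((f (x : UnitAddCircle) : ℝ) : ℂ)) =
        ((f (x : UnitAddCircle) * Real.cos (2 * Real.pi * i * x) : ℝ) : ℂ) -
        ((f (x : UnitAddCircle) * Real.sin (2 * Real.pi * i * x) : ℝ) : ℂ) * Complex.I := by
      intro x
      rw [fourier_coe_apply]
      have : 2 * (Real.pi : ℂ) * Complex.I * ((-i : ℤ) : ℂ) * (x : ℂ) / ((1 : ℝ) : ℂ) =
          ((-(2 * Real.pi * i * x) : ℝ) : ℂ) * Complex.I := by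
        push_cast; ring
      rw [this, Complex.exp_mul_I, ← Complex.ofReal_cos, ← Complex.ofReal_sin]
      simp
      ring
    have hc : ContDiff ℝ ∞ (fun x : ℝ => Real.cos (2 * Real.pi * i * x)) := by fun_prop
    have hs : ContDiff ℝ ∞ (fun x : ℝ => Real.sin (2 * Real.pi * i * x)) := by fun_prop
    have hcp : Function.Periodic (fun x : ℝ => Real.cos (2 * Real.pi * i * x)) 1 := by
      intro x
      have : 2 * Real.pi * i * (x + 1) = 2 * Real.pi * i * x + i * (2 * Real.pi) := by ring
      simp only [this, Real.cos_add_int_mul_two_pi]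
    have hsp : Function.Periodic (fun x : ℝ => Real.sin (2 * Real.pi * i * x)) 1 := by
      intro x
      have : 2 * Real.pi * i * (x + 1) = 2 * Real.pi * i * x + i * (2 * Real.pi) := by ring
      simp only [this, Real.sin_add_int_mul_two_pi]
    simp_rw [e, zero_add]
    rw [intervalIntegral.integral_sub, intervalIntegral.integral_mul_const,
      intervalIntegral.integral_ofReal, intervalIntegral.integral_ofReal, h _ hc hcp, h _ hs hsp]
    · simp
    · exact intervalIntegrable_iff.2 (intervalIntegrable_iff.1 (hint _ hc.continuous)).ofReal
    · exact IntervalIntegrable.mul_const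
        (intervalIntegrable_iff.2 (intervalIntegrable_iff.1 (hint _ hs.continuous)).ofReal) _
  have hae := hm.coeFn_toLp
  rw [hz] at hae
  have hae0 := hae.symm.trans (Lp.coeFn_zero ℂ 2 (AddCircle.haarAddCircle (T := 1)))
  have hv : (volume : Measure UnitAddCircle) = AddCircle.haarAddCircle (T := 1) := by
    rw [AddCircle.volume_eq_smul_haarAddCircle]
    simp
  rw [← hv] at hae0
  apply Lp.ext
  filter_upwards [hae0, Lp.coeFn_zero ℝ 2 (volume : Measure UnitAddCircle)] with x h1 h3
  rw [h3]
  simpa using h1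

theorem HasWeakDeriv.unique {f g g' : L2T} (h : HasWeakDeriv f g) (h' : HasWeakDeriv f g') :
    g = g' := by
  have h0 : HasWeakDeriv (f + (-1 : ℝ) • f) (g + (-1 : ℝ) • g') := h.add (h'.smul (-1))
  rw [← sub_eq_zero, sub_eq_add_neg, ← neg_one_smul ℝ g']
  refine eq_zero_of_forall_pair _ fun φ hφ hp => ?_
  have h1 := h0 φ hφ hp
  have h2 : f + (-1 : ℝ) • f = 0 := by simp
  rw [h2, pair_per_eq_inner (deriv φ) (hφ.continuous_deriv (by norm_num)) (periodic_deriv hp),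
    inner_zero_right] at h1
  linarith

theorem exists_primitive_of_integral_eq_zero (g : L2T) (hg : ∫ x, g x = 0) :
    ∃ f : L2T, HasWeakDeriv f g := by
  set G : ℝ → ℝ := fun x => g (x : UnitAddCircle) with hG
  have hGp : Function.Periodic G 1 := by
    intro x
    simp only [hG]
    congr 1
    exact AddCircle.coe_add_period 1 x
  have hG01 : IntervalIntegrable G volume 0 1 := intervalIntegrable_coe g
  have hGi : ∀ a b, IntervalIntegrable G volume a b :=
    fun a b => hGp.intervalIntegrable₀ one_ne_zero hG01 a b
  have hGz : ∫ x in (0 : ℝ)..1, G x = 0 := by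
    have h := UnitAddCircle.intervalIntegral_preimage 0 (fun x : UnitAddCircle => g x)
    rw [zero_add, hg] at h
    exact h
  set F : ℝ → ℝ := fun x => ∫ t in (0 : ℝ)..x, G t with hF
  have hFc : Continuous F := intervalIntegral.continuous_primitive hGi 0
  have hFp : Function.Periodic F 1 := by
    intro x
    have h1 := intervalIntegral.integral_add_adjacent_intervals (hGi 0 x) (hGi x (x + 1))
    have h2 := hGp.intervalIntegral_add_eq x 0
    rw [zero_add, hGz] at h2
    simp only [hF]
    rw [← h1, h2, add_zero]
  refine ⟨ContinuousMap.toLp 2 volume ℝ (perLift F hFc hFp), fun φ hφ hp => ?_⟩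
  have hF_ac : AbsolutelyContinuousOnInterval F 0 1 :=
    hG01.absolutelyContinuousOnInterval_intervalIntegral (by simp)
  have hφ_ac : AbsolutelyContinuousOnInterval φ 0 1 :=
    (hφ.of_le (by norm_num)).contDiffOn.absolutelyContinuousOnInterval
  have hparts := hF_ac.integral_mul_deriv_eq_deriv_mul hφ_ac
  have hF0 : F 0 = 0 := by simp [hF]
  have hF1 : F 1 = 0 := hGz
  have hr : ∫ x in (0 : ℝ)..1, deriv F x * φ x = ∫ x in (0 : ℝ)..1, G x * φ x := by
    refine intervalIntegral.integral_congr_ae ?_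
    filter_upwards [hG01.ae_hasDerivAt_integral] with x hx hmem
    rw [(hx (uIoc_subset_uIcc hmem) 0 (by simp)).deriv]
  rw [integral_toLp_mul, hparts, hr, hF0, hF1]
  simp [hG]

/-- The mean value projection `P f = (∫ f) 𝟏`. -/
def meanProj : L2T →ₗ[ℝ] L2T where
  toFun f := Lp.const 2 volume (∫ x, f x)
  map_add' f g := by
    rw [integral_congr_ae (Lp.coeFn_add f g)]
    simp only [Pi.add_apply]
    rw [integral_add ((Lp.memLp f).integrable (by norm_num))
      ((Lp.memLp g).integrable (by norm_num)), map_add]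
  map_smul' c f := by
    rw [integral_congr_ae (Lp.coeFn_smul c f)]
    simp only [Pi.smul_apply]
    rw [integral_smul]
    exact (Lp.constₗ 2 volume ℝ).map_smul c _

/-- The Sobolev space `H¹(𝕋)`: the `L²` functions with a weak derivative in `L²`. -/
def H1 : Submodule ℝ L2T where
  carrier := {f | ∃ g, HasWeakDeriv f g}
  add_mem' := fun ⟨g, hg⟩ ⟨g', hg'⟩ => ⟨g + g', hg.add hg'⟩
  zero_mem' := ⟨0, HasWeakDeriv.zero⟩
  smul_mem' := fun c _ ⟨g, hg⟩ => ⟨c • g, hg.smul c⟩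

/-- The weak derivative `D : H¹(𝕋) → L²(𝕋)`. -/
def weakD : H1 →ₗ[ℝ] L2T where
  toFun f := f.2.choose
  map_add' f g := (f + g).2.choose_spec.unique (f.2.choose_spec.add g.2.choose_spec)
  map_smul' c f := (c • f).2.choose_spec.unique (f.2.choose_spec.smul c)

theorem hasWeakDeriv_weakD (f : H1) : HasWeakDeriv f (weakD f) := f.2.choose_spec

/-- The perturbed derivative `D_q = D + ε^q P : H¹(𝕋) → L²(𝕋)`. -/
def Dq (ε q : ℝ) : H1 →ₗ[ℝ] L2T := weakD + ε ^ q • meanProj ∘ₗ H1.subtype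

theorem integral_const_coe (c : ℝ) :
    ∫ x, (Lp.const 2 (volume : Measure UnitAddCircle) c) x = c := by
  rw [integral_congr_ae (Lp.coeFn_const 2 (volume : Measure UnitAddCircle) c)]
  simp [measureReal_def]

theorem hasWeakDeriv_const (c : ℝ) :
    HasWeakDeriv (Lp.const 2 (volume : Measure UnitAddCircle) c) 0 := by
  have hcp : Function.Periodic (fun _ : ℝ => c) 1 := fun _ => rfl
  have he : Lp.const 2 (volume : Measure UnitAddCircle) c =
      ContinuousMap.toLp 2 volume ℝ (perLift (fun _ => c) continuous_const hcp) := by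
    apply Lp.ext
    filter_upwards [Lp.coeFn_const 2 (volume : Measure UnitAddCircle) c,
      ContinuousMap.coeFn_toLp (E := ℝ) (p := 2) (𝕜 := ℝ) (volume : Measure UnitAddCircle)
        (perLift (fun _ => c) continuous_const hcp)] with x h1 h2
    rw [h1, h2]
    obtain ⟨y, rfl⟩ := QuotientAddGroup.mk_surjective x
    rfl
  intro φ hφ hp
  have hd := hφ.continuous_deriv (by norm_num)
  rw [pair_per_eq_inner φ hφ.continuous hp 0, inner_zero_right, neg_zero,
    he, integral_toLp_mul,
    intervalIntegral.integral_const_mul,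
    intervalIntegral.integral_deriv_eq_sub
      (fun x _ => (hφ.differentiable (by norm_num)).differentiableAt)
      (hd.intervalIntegrable _ _)]
  have : φ 1 = φ 0 := by simpa using hp 0
  rw [this, sub_self, mul_zero]

theorem integral_eq_zero_of_hasWeakDeriv {f g : L2T} (h : HasWeakDeriv f g) :
    ∫ x, g x = 0 := by
  have h1 := h (fun _ => 1) contDiff_const (fun _ => rfl)
  have h2 := UnitAddCircle.intervalIntegral_preimage 0 (fun x : UnitAddCircle => g x)
  rw [zero_add] at h2
  rw [← h2]
  simpa using h1.symm

theorem integral_Dq {ε : ℝ} (q : ℝ) (f : H1) :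
    ∫ x, Dq ε q f x = ε ^ q * ∫ x, (f : L2T) x := by
  have h : Dq ε q f = weakD f + ε ^ q • meanProj f := rfl
  rw [h, integral_congr_ae (Lp.coeFn_add _ _)]
  simp only [Pi.add_apply]
  rw [integral_add ((Lp.memLp _).integrable (by norm_num))
    ((Lp.memLp _).integrable (by norm_num)),
    integral_eq_zero_of_hasWeakDeriv (hasWeakDeriv_weakD f), zero_add,
    integral_congr_ae (Lp.coeFn_smul _ _)]
  simp only [Pi.smul_apply, smul_eq_mul]
  rw [integral_const_mul]
  congr 1
  exact integral_const_coe _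

theorem Dq_injective {ε : ℝ} (hε : 0 < ε) (q : ℝ) : Function.Injective (Dq ε q) := by
  rw [injective_iff_map_eq_zero]
  intro f hf
  have hεq : ε ^ q ≠ 0 := (Real.rpow_pos_of_pos hε q).ne'
  have hmean : ∫ x, (f : L2T) x = 0 := by
    have h1 := integral_Dq (ε := ε) q f
    rw [hf, integral_congr_ae (Lp.coeFn_zero _ _ _)] at h1
    simpa [hεq] using h1.symm
  have hD : weakD f = 0 := by
    have h : weakD f + ε ^ q • meanProj f = 0 := hf
    have h2 : meanProj f = 0 := by
      change Lp.const 2 volume (∫ x, (f : L2T) x) = 0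
      rw [hmean, map_zero]
    simpa [h2] using h
  have hw := hasWeakDeriv_weakD f
  rw [hD] at hw
  refine Subtype.ext (eq_zero_of_forall_pair _ fun ψ hψ hp => ?_)
  set c : ℝ := ∫ x in (0 : ℝ)..1, ψ x with hc
  have hψi : ∀ a b, IntervalIntegrable ψ volume a b :=
    fun a b => hψ.continuous.intervalIntegrable a b
  set φ : ℝ → ℝ := fun x => (∫ t in (0 : ℝ)..x, ψ t) - c * x with hφ
  have hder : ∀ x, HasDerivAt φ (ψ x - c) x := by
    intro x
    have h1 := intervalIntegral.integral_hasDerivAt_right (hψi 0 x)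
      (hψ.continuous.stronglyMeasurableAtFilter _ _) hψ.continuous.continuousAt
    have h2 := (hasDerivAt_id x).const_mul c
    rw [mul_one] at h2
    exact h1.sub h2
  have hderiv : deriv φ = fun x => ψ x - c := funext fun x => (hder x).deriv
  have hsm : ContDiff ℝ ∞ φ := by
    rw [contDiff_infty_iff_deriv]
    refine ⟨fun x => (hder x).differentiableAt, ?_⟩
    rw [hderiv]
    exact hψ.sub contDiff_const
  have hper : Function.Periodic φ 1 := by
    intro x
    have h1 := intervalIntegral.integral_add_adjacent_intervals (hψi 0 x) (hψi x (x + 1))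
    have h2 := hp.intervalIntegral_add_eq x 0
    rw [zero_add] at h2
    simp only [hφ]
    rw [← h1, h2]
    ring
  have h3 := hw φ hsm hper
  have hz : ∫ x in (0 : ℝ)..1, (0 : L2T) (x : UnitAddCircle) * φ x = 0 := by
    rw [pair_per_eq_inner φ hsm.continuous hper, inner_zero_right]
  have hm0 : ∫ x in (0 : ℝ)..1, (f : L2T) (x : UnitAddCircle) = 0 := by
    have h := UnitAddCircle.intervalIntegral_preimage 0 (fun x : UnitAddCircle => (f : L2T) x)
    rw [zero_add] at h
    rw [h, hmean]
  rw [hz, hderiv, neg_zero] at h3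
  simp only [mul_sub] at h3
  rw [intervalIntegral.integral_sub
    ((intervalIntegrable_coe f).mul_continuousOn hψ.continuous.continuousOn)
    ((intervalIntegrable_coe f).mul_const c), intervalIntegral.integral_mul_const, hm0] at h3
  simpa using h3

theorem Dq_surjective {ε : ℝ} (hε : 0 < ε) (q : ℝ) : Function.Surjective (Dq ε q) := by
  intro g
  have hεq : ε ^ q ≠ 0 := (Real.rpow_pos_of_pos hε q).ne'
  set c : ℝ := ∫ x, g x with hc
  obtain ⟨F, hF⟩ := exists_primitive_of_integral_eq_zero (g - Lp.const 2 volume c) (by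
    rw [integral_congr_ae (Lp.coeFn_sub _ _)]
    simp only [Pi.sub_apply]
    rw [integral_sub ((Lp.memLp _).integrable (by norm_num))
      ((Lp.memLp _).integrable (by norm_num)), integral_const_coe, hc, sub_self])
  set d : ℝ := (ε ^ q)⁻¹ * c - ∫ x, F x with hd
  have hf := hF.add (hasWeakDeriv_const d)
  rw [add_zero] at hf
  refine ⟨⟨F + Lp.const 2 volume d, _, hf⟩, ?_⟩
  set f : H1 := ⟨F + Lp.const 2 volume d, _, hf⟩
  have h1 : weakD f = g - Lp.const 2 volume c := (hasWeakDeriv_weakD f).unique hf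
  have h2 : ∫ x, (F + Lp.const 2 volume d : L2T) x = (ε ^ q)⁻¹ * c := by
    rw [integral_congr_ae (Lp.coeFn_add _ _)]
    simp only [Pi.add_apply]
    rw [integral_add ((Lp.memLp _).integrable (by norm_num))
      ((Lp.memLp _).integrable (by norm_num)), integral_const_coe, hd]
    ring
  have h3 : ε ^ q • meanProj f = Lp.const 2 volume c := by
    change ε ^ q • Lp.const 2 volume (∫ x, (F + Lp.const 2 volume d : L2T) x) = _
    rw [h2]
    have h4 := (Lp.constₗ 2 (volume : Measure UnitAddCircle) ℝ).map_smul (ε ^ q)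
      ((ε ^ q)⁻¹ * c)
    rw [smul_eq_mul, mul_inv_cancel_left₀ hεq] at h4
    exact h4.symm
  change weakD f + ε ^ q • meanProj f = g
  rw [h1, h3, sub_add_cancel]

/-- The inverse of `D_q` as a linear equivalence. -/
def DqEquiv {ε : ℝ} (hε : 0 < ε) (q : ℝ) : H1 ≃ₗ[ℝ] L2T :=
  LinearEquiv.ofBijective (Dq ε q) ⟨Dq_injective hε q, Dq_surjective hε q⟩

theorem DqEquiv_symm_spec {ε : ℝ} (hε : 0 < ε) (q : ℝ) (g : L2T) :
    HasWeakDeriv ((DqEquiv hε q).symm g) (g - Lp.const 2 volume (∫ x, g x)) ∧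
      ∫ x, ((DqEquiv hε q).symm g : L2T) x = (ε ^ q)⁻¹ * ∫ x, g x := by
  have hεq : ε ^ q ≠ 0 := (Real.rpow_pos_of_pos hε q).ne'
  set f : H1 := (DqEquiv hε q).symm g
  have h0 : Dq ε q f = g := (DqEquiv hε q).apply_symm_apply g
  have h1 : ∫ x, (f : L2T) x = (ε ^ q)⁻¹ * ∫ x, g x := by
    rw [← h0, integral_Dq, inv_mul_cancel_left₀ hεq]
  refine ⟨?_, h1⟩
  have h2 : weakD f = g - Lp.const 2 volume (∫ x, g x) := by
    rw [eq_sub_iff_add_eq]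
    conv_rhs => rw [← h0]
    change _ = weakD f + ε ^ q • Lp.const 2 volume (∫ x, (f : L2T) x)
    have h4 := (Lp.constₗ 2 (volume : Measure UnitAddCircle) ℝ).map_smul (ε ^ q)
      ((ε ^ q)⁻¹ * ∫ x, g x)
    rw [smul_eq_mul, mul_inv_cancel_left₀ hεq] at h4
    rw [h1]
    exact congrArg (weakD f + ·) h4
  rw [← h2]
  exact hasWeakDeriv_weakD f

theorem tendsto_integral_L2T {u : ℕ → L2T} {g : L2T} (hu : Tendsto u atTop (𝓝 g)) :
    Tendsto (fun k => ∫ x, u k x) atTop (𝓝 (∫ x, g x)) := by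
  have h : ∀ f : L2T, ∫ x, f x = inner ℝ (Lp.const 2 volume (1 : ℝ)) f := by
    intro f
    rw [L2.inner_def]
    refine integral_congr_ae ?_
    filter_upwards [Lp.coeFn_const 2 (volume : Measure UnitAddCircle) (1 : ℝ)] with x hx
    rw [hx]
    simp
  simp only [h]
  exact tendsto_const_nhds.inner hu

theorem continuous_Dq_symm {ε : ℝ} (hε : 0 < ε) (q : ℝ) :
    Continuous (H1.subtype ∘ₗ (DqEquiv hε q).symm.toLinearMap) := by
  refine LinearMap.continuous_of_seq_closed_graph _ fun u g f hu hLu => ?_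
  simp only [LinearMap.comp_apply] at hLu ⊢
  have hmean : Tendsto (fun k => ∫ x, u k x) atTop (𝓝 (∫ x, g x)) :=
    tendsto_integral_L2T hu
  have hw : HasWeakDeriv f (g - Lp.const 2 volume (∫ x, g x)) := by
    rw [hasWeakDeriv_iff]
    intro φ hφ hp
    have hc : Tendsto (fun k => u k - Lp.const 2 volume (∫ x, u k x)) atTop
        (𝓝 (g - Lp.const 2 (volume : Measure UnitAddCircle) (∫ x, g x))) :=
      hu.sub (((Lp.constL 2 (volume : Measure UnitAddCircle) ℝ).continuous.tendsto _).comp hmean)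
    refine tendsto_nhds_unique ((tendsto_const_nhds.inner hLu).add
      (tendsto_const_nhds.inner hc)) ?_
    refine tendsto_const_nhds.congr fun k => ?_
    have hk := DqEquiv_symm_spec hε q (u k)
    exact ((hasWeakDeriv_iff _ _).1 hk.1 φ hφ hp).symm
  have hm : ∫ x, f x = (ε ^ q)⁻¹ * ∫ x, g x := by
    refine tendsto_nhds_unique (tendsto_integral_L2T hLu)
      ((hmean.const_mul (ε ^ q)⁻¹).congr fun k => ?_)
    exact (DqEquiv_symm_spec hε q (u k)).2.symm
  have hεq : ε ^ q ≠ 0 := (Real.rpow_pos_of_pos hε q).ne'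
  have hfD : DqEquiv hε q ⟨f, _, hw⟩ = g := by
    have h1 : weakD ⟨f, _, hw⟩ = g - Lp.const 2 volume (∫ x, g x) :=
      (hasWeakDeriv_weakD ⟨f, _, hw⟩).unique hw
    change weakD ⟨f, _, hw⟩ + ε ^ q • Lp.const 2 volume (∫ x, f x) = g
    have h4 := (Lp.constₗ 2 (volume : Measure UnitAddCircle) ℝ).map_smul (ε ^ q)
      ((ε ^ q)⁻¹ * ∫ x, g x)
    rw [smul_eq_mul, mul_inv_cancel_left₀ hεq] at h4
    have h5 : Lp.const 2 (volume : Measure UnitAddCircle) (∫ x, g x) =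
      ε ^ q • Lp.const 2 (volume : Measure UnitAddCircle) ((ε ^ q)⁻¹ * ∫ x, g x) := h4
    rw [h1, hm, ← h5, sub_add_cancel]
  rw [← hfD]
  simp

/-- The operator `L = D_q⁻¹ : L²(𝕋) → L²(𝕋)`. -/
def Lop {ε : ℝ} (hε : 0 < ε) (q : ℝ) : L2T →L[ℝ] L2T :=
  ⟨H1.subtype ∘ₗ (DqEquiv hε q).symm.toLinearMap, continuous_Dq_symm hε q⟩

/-! ### Multiplication operators and the covariance of the limit -/

/-- Multiplication by an essentially bounded function, as a bounded operator on `L²(𝕋)`. -/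
def mulOp (m : UnitAddCircle → ℝ) (hm : MemLp m ∞ volume) : L2T →L[ℝ] L2T :=
  (ContinuousLinearMap.mul ℝ ℝ).holderL volume ∞ 2 2 (hm.toLp m)

theorem memLp_inv {ε : ℝ} (hε : 0 < ε) {v : UnitAddCircle → ℝ}
    (hv : AEStronglyMeasurable v volume) :
    MemLp (fun x => (ε ^ 2 + v x ^ 2)⁻¹) ∞ (volume : Measure UnitAddCircle) := by
  refine memLp_top_of_bound (C := (ε ^ 2)⁻¹) ?_ ?_
  · exact (((hv.aemeasurable.pow_const 2).const_add _).inv).aestronglyMeasurable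
  · refine Eventually.of_forall fun x => ?_
    rw [Real.norm_of_nonneg (by positivity)]
    gcongr
    nlinarith [sq_nonneg (v x)]

/-- `Λ(v)`: multiplication by `(ε² + v²)⁻¹`. -/
def Lam {ε : ℝ} (hε : 0 < ε) (v : L2T) : L2T →L[ℝ] L2T :=
  mulOp (fun x => (ε ^ 2 + v x ^ 2)⁻¹) (memLp_inv hε (Lp.aestronglyMeasurable v))

/-- The covariance operator `C_U(v) = L Λ(v) L*`. -/
def CU {ε : ℝ} (hε : 0 < ε) (q : ℝ) (v : L2T) : L2T →L[ℝ] L2T :=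
  Lop hε q ∘L Lam hε v ∘L ContinuousLinearMap.adjoint (Lop hε q)

/-- `μ` is a centred Gaussian measure on `L²(𝕋)` with covariance operator `C`. -/
structure IsCenteredGaussian (μ : Measure L2T) (C : L2T →L[ℝ] L2T) : Prop where
  isGaussian : IsGaussian μ
  integral_eq_zero : ∫ u, u ∂μ = 0
  covariance : ∀ φ ψ : L2T, ∫ u, inner ℝ u φ * inner ℝ u ψ ∂μ = inner ℝ (C φ) ψ

/-! ### The dyadic mesh and the discretised conditional law -/

/-- The mesh cell `K_j = [j / 2ⁿ, (j + 1) / 2ⁿ)`, for `0 ≤ j < 2ⁿ`, as a subset of the circle. -/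
def cell (n : ℕ) (j : Fin (2 ^ n)) : Set UnitAddCircle :=
  (fun t : ℝ => (t : UnitAddCircle)) '' Ico ((j : ℝ) / 2 ^ n) (((j : ℝ) + 1) / 2 ^ n)

/-- `PL(n)`: the continuous functions on the circle that are linear (that is, affine) on each
mesh cell. -/
def PL (n : ℕ) : Submodule ℝ C(UnitAddCircle, ℝ) where
  carrier := {f | ∀ j : Fin (2 ^ n), ∃ a b : ℝ,
    ∀ t ∈ Ico ((j : ℝ) / 2 ^ n) (((j : ℝ) + 1) / 2 ^ n), f (t : UnitAddCircle) = a * t + b}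
  add_mem' := by
    intro f g hf hg j
    obtain ⟨a, b, h⟩ := hf j
    obtain ⟨a', b', h'⟩ := hg j
    refine ⟨a + a', b + b', fun t ht => ?_⟩
    rw [ContinuousMap.add_apply, h t ht, h' t ht]
    ring
  zero_mem' := fun _ => ⟨0, 0, fun t _ => by simp⟩
  smul_mem' := by
    intro c f hf j
    obtain ⟨a, b, h⟩ := hf j
    refine ⟨c * a, c * b, fun t ht => ?_⟩
    rw [ContinuousMap.smul_apply, h t ht, smul_eq_mul]
    ring

/-- `PL(n)` as a subspace of `L²(𝕋)`. -/
def PL2 (n : ℕ) : Submodule ℝ L2T :=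
  (PL n).map (ContinuousMap.toLp 2 (volume : Measure UnitAddCircle) ℝ).toLinearMap

/-- `Q_n v`: the step function whose value on each mesh cell is the mean of `v` over it. -/
def Qn (n : ℕ) (v : L2T) : UnitAddCircle → ℝ := fun x =>
  2 ^ n * ∑ j : Fin (2 ^ n), (∫ y in cell n j, v y) * (cell n j).indicator 1 x

theorem measurableSet_cell (n : ℕ) (j : Fin (2 ^ n)) : MeasurableSet (cell n j) := by
  refine measurableSet_Ico.image_of_measurable_injOn AddCircle.measurable_mk' ?_
  intro x hx y hy hxy
  have hN : (0 : ℝ) < 2 ^ n := by positivity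
  have hj : ((j : ℝ) + 1) / 2 ^ n ≤ 1 := by
    rw [div_le_one hN]
    exact_mod_cast j.2
  have hj0 : (0 : ℝ) ≤ (j : ℝ) / 2 ^ n := by positivity
  refine (AddCircle.coe_eq_coe_iff_of_mem_Ico (p := (1 : ℝ)) (a := 0) ?_ ?_).1 hxy
  · exact ⟨hj0.trans hx.1, by linarith [hx.2]⟩
  · exact ⟨hj0.trans hy.1, by linarith [hy.2]⟩

theorem measurable_Qn (n : ℕ) (v : L2T) : Measurable (Qn n v) := by
  unfold Qn
  refine Measurable.const_mul (Finset.measurable_sum _ fun j _ => ?_) _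
  exact (measurable_one.indicator (measurableSet_cell n j)).const_mul _

/-- `Λ_n(v)`: multiplication by `(ε² + (Q_n v)²)⁻¹`. -/
def LamN {ε : ℝ} (hε : 0 < ε) (n : ℕ) (v : L2T) : L2T →L[ℝ] L2T :=
  mulOp (fun x => (ε ^ 2 + Qn n v x ^ 2)⁻¹)
    (memLp_inv hε (measurable_Qn n v).aestronglyMeasurable)

/-- `(f_j)` is an orthonormal system in `H¹(𝕋)` for the inner product `⟨D_q f, D_q g⟩` such that
for each `n ≥ 1` its first `2ⁿ` members span `PL(n)`. -/
structure IsPLBasis (ε q : ℝ) (f : ℕ → H1) : Prop where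
  orthonormal : Orthonormal ℝ fun j => Dq ε q (f j)
  span_eq : ∀ n : ℕ, 1 ≤ n →
    Submodule.span ℝ (range fun j : Fin (2 ^ n) => (f j : L2T)) = PL2 n

/-- The random coefficients' covariance matrix `𝐂_{jk} = ⟨Λ_n(v) D_q f_j, D_q f_k⟩`. -/
def covMatrix {ε : ℝ} (hε : 0 < ε) (q : ℝ) (f : ℕ → H1) (n : ℕ) (v : L2T) :
    Matrix (Fin (2 ^ n)) (Fin (2 ^ n)) ℝ :=
  Matrix.of fun j k => inner ℝ (LamN hε n v (Dq ε q (f j))) (Dq ε q (f k))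

/-- `λ_n^v`: the law on `L²(𝕋)` of `∑_j 𝐔_j f_j`, where `𝐔 = 𝐂^{1/2} 𝐖` and `𝐖` is a standard
Gaussian vector. -/
def lamN {ε : ℝ} (hε : 0 < ε) (q : ℝ) (f : ℕ → H1) (n : ℕ) (v : L2T) : Measure L2T :=
  (multivariateGaussian 0 (covMatrix hε q f n v)).map fun u => ∑ j : Fin (2 ^ n), u j • (f j : L2T)

/-! ### Fractional Sobolev spaces -/

/-- The norm of the fractional Sobolev (Sobolev-Slobodeckij) space `W^{t,p}(𝕋)`, `0 < t < 1`,
with values in `[0, ∞]`: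
`‖v‖^p = ∫ |v|^p + ∬ |v(x) - v(y)|^p / |x - y|^{1 + t p} dx dy`. -/
def sobolevNorm (t p : ℝ) (v : UnitAddCircle → ℝ) : ℝ≥0∞ :=
  ((∫⁻ x, ‖v x‖ₑ ^ p) +
    ∫⁻ x, ∫⁻ y, ‖v x - v y‖ₑ ^ p / edist x y ^ (1 + t * p)) ^ p⁻¹

end HierPrior
end

/-! A finite measure on a separable Hilbert space is determined by its characteristic function, so
weak convergence follows from tightness together with pointwise convergence of characteristic
functions. Put `N = 2 ^ n` and let `P_N` be the orthogonal projection onto the span of the first `N`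
vectors `D_q f_j`. Since `⟨f_j, φ⟩ = ⟨L D_q f_j, φ⟩ = ⟨D_q f_j, L* φ⟩`, the variance of `φ` under
the discretized law is `⟨Λ_n(v_n) P_N L* φ, P_N L* φ⟩` (`covForm`, `charFun_lamN`).

Convergence (`tendsto_covForm`): `P_N → 1` strongly because the `D_q f_j` are complete. Indeed `L`
sends indicators of dyadic arcs to piecewise linear functions, and a function with zero integral
over every dyadic arc vanishes. Moreover `Q_n v_n → v` in `L¹`, hence in measure, and dominated
convergence handles the bounded multipliers. The limit is `⟨Λ(v) L* φ, L* φ⟩ = ⟨C_U(v) φ, φ⟩`.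

Tightness (`isTightMeasureSet_lamN`): multipliers are at most `ε⁻²` and projections contract, so the
variance along a basis vector `b_i` is at most `ε⁻² ‖L* b_i‖²` for all `n`. This is summable because
`L` is Hilbert-Schmidt, which in turn holds because `L` maps `L²` boundedly into the continuous
functions.

Existence of the limit Gaussian comes for free: it is the weak limit, recognised by its
characteristic function. -/

noncomputable section

namespace HierPrior

/-! ### Tightness and Lévy continuity on a Hilbert space. -/

section Hilbert

variable {H : Type*} [NormedAddCommGroup H] [InnerProductSpace ℝ H]

/-- The partial sum of the Fourier expansion along an orthonormal sequence. -/
def partialSum (b : ℕ → H) (m : ℕ) : H →L[ℝ] H :=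
  ∑ i ∈ Finset.range m, (innerSL ℝ (b i)).smulRight (b i)

theorem partialSum_apply (b : ℕ → H) (m : ℕ) (u : H) :
    partialSum b m u = ∑ i ∈ Finset.range m, inner ℝ (b i) u • b i := by
  simp [partialSum]

theorem inner_partialSum {b : ℕ → H} (hb : Orthonormal ℝ b) (m i : ℕ) (u : H) :
    inner ℝ (b i) (partialSum b m u) = if i < m then inner ℝ (b i) u else 0 := by
  rw [partialSum_apply, inner_sum]
  simp_rw [inner_smul_right, orthonormal_iff_ite.1 hb]
  simp

theorem totallyBounded_partialSum_image (b : ℕ → H) (hb : Orthonormal ℝ b) (m : ℕ) (M : ℝ) :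
    TotallyBounded (partialSum b m '' Metric.closedBall 0 M) := by
  -- `M` may be negative; `max M 0` keeps the radius of the coordinate cube nonnegative.
  have hK : IsCompact ((fun c : Fin m → ℝ => ∑ i, c i • b i) '' Metric.closedBall 0 (max M 0)) :=
    (isCompact_closedBall _ _).image (by fun_prop)
  refine hK.totallyBounded.subset ?_
  rintro _ ⟨u, hu, rfl⟩
  refine ⟨fun i => inner ℝ (b i) u, ?_, ?_⟩
  · rw [mem_closedBall_zero_iff] at hu ⊢
    rw [pi_norm_le_iff_of_nonneg (le_max_right _ _)]
    intro i
    refine (norm_inner_le_norm _ _).trans ?_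
    rw [hb.1, one_mul]
    exact hu.trans (le_max_left _ _)
  · rw [partialSum_apply, Finset.sum_range]

/-- A bounded set approximated uniformly, to any accuracy, by finite-rank images is totally bounded.
These are the compact sets used for tightness. -/
theorem isCompact_setOf_norm_sub_partialSum_le [CompleteSpace H] (b : ℕ → H)
    (hb : Orthonormal ℝ b) (M : ℝ) (m : ℕ → ℕ) {η : ℕ → ℝ} (hη : Tendsto η atTop (𝓝 0)) :
    IsCompact (Metric.closedBall (0 : H) M ∩ ⋂ k, {u | ‖u - partialSum b (m k) u‖ ≤ η k}) := by
  refine TotallyBounded.isCompact_of_isClosed ?_ ?_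
  · rw [Metric.totallyBounded_iff]
    intro r hr
    obtain ⟨k, hk⟩ := (hη.eventually (gt_mem_nhds (half_pos hr))).exists
    obtain ⟨t, ht, hcov⟩ :=
      Metric.totallyBounded_iff.1 (totallyBounded_partialSum_image b hb (m k) M) _ (half_pos hr)
    refine ⟨t, ht, fun u hu => ?_⟩
    obtain ⟨y, hy, huy⟩ := mem_iUnion₂.1 (hcov ⟨u, hu.1, rfl⟩)
    refine mem_iUnion₂.2 ⟨y, hy, ?_⟩
    have h1 : dist u (partialSum b (m k) u) ≤ η k := by
      rw [dist_eq_norm]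
      exact mem_iInter.1 hu.2 k
    rw [Metric.mem_ball] at huy ⊢
    linarith [dist_triangle u (partialSum b (m k) u) y]
  · refine Metric.isClosed_closedBall.inter (isClosed_iInter fun k => ?_)
    exact isClosed_le (by fun_prop) continuous_const

/-- Parseval for the remainder, whose first `m` coefficients vanish. -/
theorem enorm_sub_partialSum_sq_le (b : HilbertBasis ℕ ℝ H) (m : ℕ) (u : H) :
    ‖u - partialSum b m u‖ₑ ^ 2 ≤ ∑' i, ‖inner ℝ (b (i + m)) u‖ₑ ^ 2 := by
  set y := u - partialSum b m u
  have hs := b.hasSum_inner_mul_inner y y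
  have hin : ∀ i, inner ℝ (b i) y = if i < m then 0 else inner ℝ (b i) u := by
    intro i
    rw [inner_sub_right, inner_partialSum b.orthonormal]
    split_ifs <;> simp
  have hs' : HasSum (fun i => inner ℝ (b (i + m)) u ^ 2) (‖y‖ ^ 2) := by
    rw [← real_inner_self_eq_norm_sq]
    have h2 := (hasSum_nat_add_iff' m).2 hs
    have h3 : ∑ i ∈ Finset.range m, inner ℝ y (b i) * inner ℝ (b i) y = 0 := by
      refine Finset.sum_eq_zero fun i hi => ?_
      rw [hin, if_pos (Finset.mem_range.1 hi), mul_zero]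
    rw [h3, sub_zero] at h2
    refine h2.congr_fun fun i => ?_
    rw [real_inner_comm (b (i + m)) y, hin, if_neg (by omega), sq]
  have h4 : ∀ x : ℝ, ‖x‖ₑ ^ 2 = ENNReal.ofReal (x ^ 2) := by
    intro x
    rw [← sq_abs, ENNReal.ofReal_pow (abs_nonneg x), ← Real.norm_eq_abs, ofReal_norm]
  have h5 : ‖y‖ₑ ^ 2 = ENNReal.ofReal (‖y‖ ^ 2) := by
    rw [ENNReal.ofReal_pow (norm_nonneg y), ofReal_norm]
  rw [h5, ← hs'.tsum_eq, ENNReal.ofReal_tsum_of_nonneg (fun _ => sq_nonneg _) hs'.summable]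
  simp_rw [h4]
  exact le_rfl

variable [CompleteSpace H] [MeasurableSpace H] [BorelSpace H]

/-- The tails `D m` of the summable majorant bound the mean square distance to the `m`-th partial
sum uniformly over `S`; Chebyshev then bounds the mass outside the compact sets above. -/
theorem isTightMeasureSet_of_second_moment_le (b : HilbertBasis ℕ ℝ H) (S : Set (Measure H))
    (s : ℕ → ℝ≥0∞) (hs : ∑' i, s i ≠ ⊤)
    (h : ∀ μ ∈ S, ∀ i, ∫⁻ u, ‖inner ℝ (b i) u‖ₑ ^ 2 ∂μ ≤ s i) : IsTightMeasureSet S := by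
  set D : ℕ → ℝ≥0∞ := fun m => ∑' i, s (i + m) with hD
  have hD0 : Tendsto D atTop (𝓝 0) := ENNReal.tendsto_sum_nat_add s hs
  have hmom : ∀ μ ∈ S, ∀ m, ∫⁻ u, ‖u - partialSum b m u‖ₑ ^ 2 ∂μ ≤ D m := by
    intro μ hμ m
    calc _ ≤ ∫⁻ u, ∑' i, ‖inner ℝ (b (i + m)) u‖ₑ ^ 2 ∂μ :=
          lintegral_mono fun u => enorm_sub_partialSum_sq_le b m u
      _ = ∑' i, ∫⁻ u, ‖inner ℝ (b (i + m)) u‖ₑ ^ 2 ∂μ := by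
          refine lintegral_tsum fun i => ?_
          have : Continuous fun u : H => inner ℝ (b (i + m)) u := by fun_prop
          exact (this.measurable.enorm.pow_const 2).aemeasurable
      _ ≤ _ := ENNReal.tsum_le_tsum fun i => h μ hμ _
  have hcheb : ∀ μ ∈ S, ∀ m, ∀ η : ℝ, 0 < η →
      μ {u | ‖u - partialSum b m u‖ ≤ η}ᶜ ≤ D m / ENNReal.ofReal η ^ 2 := by
    intro μ hμ m η hη
    have hc : Continuous fun u : H => u - partialSum b m u := by fun_prop
    have h1 := meas_ge_le_lintegral_div (μ := μ)
      (f := fun u : H => ‖u - partialSum b m u‖ₑ ^ 2)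
      ((hc.measurable.enorm.pow_const 2).aemeasurable) (ε := ENNReal.ofReal η ^ 2)
      (by simpa using hη) (by simp)
    refine (measure_mono ?_).trans (h1.trans (ENNReal.div_le_div_right (hmom μ hμ m) _))
    intro u hu
    simp only [mem_compl_iff, mem_ofPred_eq, not_le] at hu ⊢
    gcongr
    rw [← ofReal_norm]
    exact ENNReal.ofReal_le_ofReal hu.le
  rw [isTightMeasureSet_iff_exists_isCompact_measure_compl_le]
  intro ε hε
  have hε2 : ε / 2 ≠ 0 := by simpa using hε.ne'
  -- Half of `ε` pays for leaving the ball; the other half is split into `δ k`, one for each tail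
  -- condition.
  obtain ⟨δ, hδ, hδs⟩ := ENNReal.exists_pos_sum_of_countable' hε2 ℕ
  set η : ℕ → ℝ := fun k => 1 / ((k : ℝ) + 1) with hη
  have hηpos : ∀ k, 0 < η k := fun k => by positivity
  have hm : ∀ k, ∃ m, D m ≤ δ k * ENNReal.ofReal (η k) ^ 2 := by
    intro k
    have : 0 < δ k * ENNReal.ofReal (η k) ^ 2 :=
      ENNReal.mul_pos (hδ k).ne' (pow_ne_zero _ (by simpa using hηpos k))
    obtain ⟨m, hm⟩ := (hD0.eventually (gt_mem_nhds this)).exists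
    exact ⟨m, hm.le⟩
  choose m hm using hm
  have hDtop : D 0 ≠ ⊤ := by simpa [hD] using hs
  obtain ⟨M, hM⟩ := ENNReal.exists_nat_gt (ENNReal.div_ne_top hDtop hε2)
  have hM0 : 0 < M := by
    rcases Nat.eq_zero_or_pos M with rfl | h
    · simp at hM
    · exact h
  refine ⟨_, isCompact_setOf_norm_sub_partialSum_le b b.orthonormal M m
    tendsto_one_div_add_atTop_nhds_zero_nat, fun μ hμ => ?_⟩
  rw [compl_inter, compl_iInter]
  refine (measure_union_le _ _).trans ?_
  rw [← ENNReal.add_halves ε]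
  refine add_le_add ?_ ?_
  · have h1 := hcheb μ hμ 0 M (by exact_mod_cast hM0)
    have h2 : {u : H | ‖u - partialSum b 0 u‖ ≤ (M : ℝ)} = Metric.closedBall 0 M := by
      ext u; simp [partialSum]
    rw [h2] at h1
    refine h1.trans ?_
    rw [ENNReal.ofReal_natCast]
    refine ENNReal.div_le_of_le_mul ?_
    have h3 : D 0 ≤ ε / 2 * M := by
      rw [mul_comm]
      by_cases htop : ε / 2 = ⊤
      · rw [htop, ENNReal.mul_top (by exact_mod_cast hM0.ne')]
        exact le_top
      exact (ENNReal.div_le_iff hε2 htop).1 hM.le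
    refine h3.trans ?_
    gcongr
    exact_mod_cast Nat.le_self_pow two_ne_zero M
  · refine (measure_iUnion_le _).trans (le_trans (ENNReal.tsum_le_tsum fun k => ?_) hδs.le)
    refine (hcheb μ hμ (m k) (η k) (hηpos k)).trans ?_
    exact ENNReal.div_le_of_le_mul (hm k)

/-- `F` need not be known to be a characteristic function: Prokhorov supplies a cluster point, and
its characteristic function must be `F`. -/
theorem exists_tendsto_of_isTightMeasureSet_of_tendsto_charFun [SecondCountableTopology H]
    (μ : ℕ → ProbabilityMeasure H) (hμ : IsTightMeasureSet {(μ n : Measure H) | n}) (F : H → ℂ)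
    (hF : ∀ t, Tendsto (fun n => charFun (μ n : Measure H) t) atTop (𝓝 (F t))) :
    ∃ ν : ProbabilityMeasure H, Tendsto μ atTop (𝓝 ν) ∧ ∀ t, charFun (ν : Measure H) t = F t := by
  have h_compact : IsCompact (closure {μ n | n}) :=
    isCompact_closure_of_isTightMeasureSet (by simpa using hμ)
  -- An ultrafilter finer than `atTop` plays the role of a convergent subsequence.
  set U : Ultrafilter ℕ := Ultrafilter.of atTop
  have hU : (U : Filter ℕ) ≤ atTop := Ultrafilter.of_le _
  obtain ⟨ν, -, hν⟩ := h_compact.ultrafilter_le_nhds (U.map μ)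
    (.trans (by simp) (monotone_principal subset_closure))
  have hν' : Tendsto μ U (𝓝 ν) := hν
  have hchar : ∀ t, charFun (ν : Measure H) t = F t := by
    intro t
    refine tendsto_nhds_unique ?_ ((hF t).comp hU)
    rw [ProbabilityMeasure.tendsto_iff_forall_integral_rclike_tendsto ℂ] at hν'
    simp_rw [Function.comp_def, charFun_eq_integral_innerProbChar]
    exact hν' (BoundedContinuousFunction.innerProbChar t)
  refine ⟨ν, ?_, hchar⟩
  -- For a tight sequence it suffices to test against a point-separating algebra, here the
  -- trigonometric polynomials.
  refine ProbabilityMeasure.tendsto_of_tight_of_separatesPoints hμ (𝕜 := ℂ)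
    (A := BoundedContinuousFunction.charPoly Real.continuous_probChar
      (L := innerₗ H) continuous_inner) ?_ ?_
  · refine BoundedContinuousFunction.separatesPoints_charPoly
      Real.continuous_probChar Real.probChar_ne_one _ ?_
    exact fun v hv => DFunLike.ne_iff.mpr ⟨v, inner_self_ne_zero.mpr hv⟩
  · refine fun g => ProbabilityMeasure.tendsto_charPoly_of_tendsto_charFun fun t => ?_
    rw [hchar]
    exact hF t

end Hilbert

instance isProbabilityMeasure_volume_unitAddCircle :
    IsProbabilityMeasure (volume : Measure UnitAddCircle) := ⟨UnitAddCircle.measure_univ⟩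

instance secondCountableTopology_L2T : SecondCountableTopology L2T :=
  haveI : Fact ((2 : ℝ≥0∞) ≠ ⊤) := ⟨by norm_num⟩
  inferInstance

/-! ### The range of `L = D_q⁻¹` -/

/-- Integration by parts for absolutely continuous functions; periodicity cancels the boundary
terms. -/
theorem hasWeakDeriv_of_primitive {F : ℝ → ℝ} (hFc : Continuous F) (hFp : Function.Periodic F 1)
    (h : L2T) (d : ℝ) (hF : ∀ x, F x = d + ∫ t in (0 : ℝ)..x, h (t : UnitAddCircle)) :
    HasWeakDeriv (ContinuousMap.toLp 2 volume ℝ (perLift F hFc hFp)) h := by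
  intro φ hφ hp
  have hi : IntervalIntegrable (fun x : ℝ => h (x : UnitAddCircle)) volume 0 1 :=
    intervalIntegrable_coe h
  have hF_ac : AbsolutelyContinuousOnInterval F 0 1 := by
    have h1 := hi.absolutelyContinuousOnInterval_intervalIntegral (c := 0) (by simp)
    have h2 : AbsolutelyContinuousOnInterval (fun _ : ℝ => d) 0 1 :=
      (contDiff_const (n := 1)).contDiffOn.absolutelyContinuousOnInterval
    have h3 := h2.add h1
    rwa [show F = (fun _ : ℝ => d) + fun x => ∫ t in (0 : ℝ)..x, h (t : UnitAddCircle) from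
      funext hF]
  have hφ_ac : AbsolutelyContinuousOnInterval φ 0 1 :=
    (hφ.of_le (by norm_num)).contDiffOn.absolutelyContinuousOnInterval
  have hr : ∫ x in (0 : ℝ)..1, deriv F x * φ x =
      ∫ x in (0 : ℝ)..1, h (x : UnitAddCircle) * φ x := by
    refine intervalIntegral.integral_congr_ae ?_
    filter_upwards [hi.ae_hasDerivAt_integral] with x hx hmem
    have h1 := (hx (uIoc_subset_uIcc hmem) 0 (by simp)).const_add d
    rw [← show F = _ from funext hF] at h1
    rw [h1.deriv]
  have hF1 : F 1 = F 0 := by simpa using hFp 0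
  have hφ1 : φ 1 = φ 0 := by simpa using hp 0
  rw [integral_toLp_mul, hF_ac.integral_mul_deriv_eq_deriv_mul hφ_ac, hr, hF1, hφ1, sub_self,
    zero_sub]

/-- The hypotheses are the zero-mean part and the mean of the equation `D_q f = g`. -/
theorem Lop_eq_of_hasWeakDeriv {ε : ℝ} (hε : 0 < ε) (q : ℝ) {f g : L2T}
    (hw : HasWeakDeriv f (g - Lp.const 2 volume (∫ x, g x)))
    (hm : ∫ x, f x = (ε ^ q)⁻¹ * ∫ x, g x) : Lop hε q g = f := by
  have hεq : ε ^ q ≠ 0 := (Real.rpow_pos_of_pos hε q).ne'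
  have hfD : DqEquiv hε q ⟨f, _, hw⟩ = g := by
    have h1 : weakD ⟨f, _, hw⟩ = g - Lp.const 2 volume (∫ x, g x) :=
      (hasWeakDeriv_weakD ⟨f, _, hw⟩).unique hw
    change weakD ⟨f, _, hw⟩ + ε ^ q • Lp.const 2 volume (∫ x, f x) = g
    have h4 := (Lp.constₗ 2 (volume : Measure UnitAddCircle) ℝ).map_smul (ε ^ q)
      ((ε ^ q)⁻¹ * ∫ x, g x)
    rw [smul_eq_mul, mul_inv_cancel_left₀ hεq] at h4
    have h5 : Lp.const 2 (volume : Measure UnitAddCircle) (∫ x, g x) =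
      ε ^ q • Lp.const 2 (volume : Measure UnitAddCircle) ((ε ^ q)⁻¹ * ∫ x, g x) := h4
    rw [h1, hm, ← h5, sub_add_cancel]
  change ((DqEquiv hε q).symm g : L2T) = f
  rw [← hfD]
  simp

theorem Lop_Dq {ε : ℝ} (hε : 0 < ε) (q : ℝ) (f : H1) : Lop hε q (Dq ε q f) = f := by
  change ((DqEquiv hε q).symm (DqEquiv hε q f) : L2T) = f
  simp

theorem integral_coe_eq (g : L2T) : ∫ x in (0 : ℝ)..1, g (x : UnitAddCircle) = ∫ x, g x := by
  have h := UnitAddCircle.intervalIntegral_preimage 0 (fun x : UnitAddCircle => g x)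
  rwa [zero_add] at h

theorem integral_abs_le_norm (g : L2T) : ∫ x, |g x| ≤ ‖g‖ := by
  have h1 : eLpNorm g 1 (volume : Measure UnitAddCircle) ≤ eLpNorm g 2 volume :=
    eLpNorm_le_eLpNorm_of_exponent_le (by norm_num) (Lp.aestronglyMeasurable g)
  have h2 := ENNReal.toReal_mono (Lp.eLpNorm_ne_top g) h1
  rw [← Lp.norm_def] at h2
  refine le_trans (le_of_eq ?_) h2
  rw [eLpNorm_one_eq_lintegral_enorm,
    ← integral_norm_eq_lintegral_enorm (Lp.aestronglyMeasurable g)]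
  rfl

theorem abs_intervalIntegral_coe_le (g : L2T) {x : ℝ} (hx : x ∈ Icc (0 : ℝ) 1) :
    |∫ t in (0 : ℝ)..x, g (t : UnitAddCircle)| ≤ ‖g‖ := by
  refine le_trans ?_ (integral_abs_le_norm g)
  have h := UnitAddCircle.intervalIntegral_preimage 0 (fun x : UnitAddCircle => |g x|)
  rw [zero_add] at h
  rw [← h]
  refine (intervalIntegral.abs_integral_le_integral_abs hx.1).trans ?_
  exact intervalIntegral.integral_mono_interval le_rfl hx.1 hx.2
    (Eventually.of_forall fun _ => abs_nonneg _) (intervalIntegrable_coe g).abs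

theorem coe_sub_const_ae (g : L2T) (c : ℝ) : ∀ᵐ t : ℝ ∂volume.restrict (Ioc 0 1),
    (g - Lp.const 2 volume c : L2T) (t : UnitAddCircle) = g (t : UnitAddCircle) - c := by
  have hq := (UnitAddCircle.measurePreserving_mk 0).quasiMeasurePreserving.ae_eq_comp
    ((Lp.coeFn_sub g (Lp.const 2 volume c)).trans
      ((EventuallyEq.refl _ _).sub (Lp.coeFn_const 2 (volume : Measure UnitAddCircle) c)))
  rw [zero_add] at hq
  filter_upwards [hq] with t ht
  exact ht

theorem intervalIntegral_coe_sub_const (g : L2T) (c : ℝ) {x : ℝ} (hx : x ∈ Icc (0 : ℝ) 1) :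
    ∫ t in (0 : ℝ)..x, (g - Lp.const 2 volume c : L2T) (t : UnitAddCircle) =
      (∫ t in (0 : ℝ)..x, g (t : UnitAddCircle)) - c * x := by
  have hsub : Ioc 0 x ⊆ Ioc (0 : ℝ) 1 := Ioc_subset_Ioc_right hx.2
  have hi : IntervalIntegrable (fun t : ℝ => g (t : UnitAddCircle)) volume 0 x :=
    (intervalIntegrable_coe g).mono_set (by
      rw [uIcc_of_le hx.1, uIcc_of_le zero_le_one]
      exact Icc_subset_Icc_right hx.2)
  have h1 : ∫ t in (0 : ℝ)..x, (g - Lp.const 2 volume c : L2T) (t : UnitAddCircle) =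
      ∫ t in (0 : ℝ)..x, (g (t : UnitAddCircle) - c) := by
    rw [intervalIntegral.integral_of_le hx.1, intervalIntegral.integral_of_le hx.1]
    exact integral_congr_ae (ae_restrict_of_ae_restrict_of_subset hsub (coe_sub_const_ae g c))
  rw [h1, intervalIntegral.integral_sub hi intervalIntegrable_const,
    intervalIntegral.integral_const]
  simp [mul_comm]

/-- `L g` has a continuous representative, an explicit primitive of `g - ∫ g`. -/
theorem exists_Lop_eq_toLp {ε : ℝ} (hε : 0 < ε) (q : ℝ) (g : L2T) :
    ∃ (F : C(UnitAddCircle, ℝ)) (d : ℝ), ContinuousMap.toLp 2 volume ℝ F = Lop hε q g ∧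
      |d| ≤ (2 + (ε ^ q)⁻¹) * ‖g‖ ∧ ∀ x ∈ Icc (0 : ℝ) 1, F (x : UnitAddCircle) =
        (∫ t in (0 : ℝ)..x, g (t : UnitAddCircle)) - (∫ y, g y) * x + d := by
  set c := ∫ y, g y with hc
  set h : L2T := g - Lp.const 2 volume c with hh
  have hhp : Function.Periodic (fun x : ℝ => h (x : UnitAddCircle)) 1 := by
    intro x
    simp
  have hi : ∀ a b, IntervalIntegrable (fun x : ℝ => h (x : UnitAddCircle)) volume a b :=
    fun a b => hhp.intervalIntegrable₀ one_ne_zero (intervalIntegrable_coe h) a b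
  have hz : ∫ x in (0 : ℝ)..1, h (x : UnitAddCircle) = 0 := by
    rw [hh, intervalIntegral_coe_sub_const g c (by simp), integral_coe_eq, mul_one, sub_self]
  set F0 : ℝ → ℝ := fun x => ∫ t in (0 : ℝ)..x, h (t : UnitAddCircle) with hF0
  have hF0c : Continuous F0 := intervalIntegral.continuous_primitive hi 0
  have hF0b : ∀ x ∈ Icc (0 : ℝ) 1, |F0 x| ≤ 2 * ‖g‖ := by
    intro x hx
    simp only [hF0, hh]
    rw [intervalIntegral_coe_sub_const g c hx]
    have h1 := abs_intervalIntegral_coe_le g hx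
    have h2 := abs_intervalIntegral_coe_le g (x := 1) (by simp)
    rw [integral_coe_eq, ← hc] at h2
    have h3 : |c * x| ≤ ‖g‖ := by
      rw [abs_mul, abs_of_nonneg hx.1]
      nlinarith [hx.2, abs_nonneg c, hx.1]
    linarith [abs_sub (∫ t in (0 : ℝ)..x, g (t : UnitAddCircle)) (c * x)]
  -- The constant of integration that gives the primitive the mean `ε^{-q} ∫ g` required of `L g`.
  set d : ℝ := (ε ^ q)⁻¹ * c - ∫ x in (0 : ℝ)..1, F0 x with hd
  set F : ℝ → ℝ := fun x => d + F0 x with hF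
  have hFc : Continuous F := by fun_prop
  have hFp : Function.Periodic F 1 := by
    intro x
    have h1 := intervalIntegral.integral_add_adjacent_intervals (hi 0 x) (hi x (x + 1))
    have h2 := hhp.intervalIntegral_add_eq x 0
    rw [zero_add, hz] at h2
    simp only [hF, hF0]
    rw [← h1, h2, add_zero]
  refine ⟨perLift F hFc hFp, d, ?_, ?_, ?_⟩
  · refine (Lop_eq_of_hasWeakDeriv hε q
      (hasWeakDeriv_of_primitive hFc hFp h d fun _ => rfl) ?_).symm
    have h1 := integral_toLp_mul F hFc hFp (fun _ => 1)
    simp only [mul_one] at h1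
    rw [integral_coe_eq] at h1
    rw [h1]
    simp only [hF]
    rw [intervalIntegral.integral_add intervalIntegrable_const (hF0c.intervalIntegrable _ _)]
    simp [hd]
    exact Or.inl hc
  · have h1 : |∫ x in (0 : ℝ)..1, F0 x| ≤ 2 * ‖g‖ := by
      have := intervalIntegral.norm_integral_le_of_norm_le_const (a := (0 : ℝ)) (b := 1) (f := F0)
        (C := 2 * ‖g‖) (fun x hx => by
          rw [uIoc_of_le zero_le_one] at hx
          exact hF0b x (Ioc_subset_Icc_self hx))
      simpa using this
    have h2 := abs_intervalIntegral_coe_le g (x := 1) (by simp)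
    rw [integral_coe_eq, ← hc] at h2
    have h3 : |(ε ^ q)⁻¹ * c| ≤ (ε ^ q)⁻¹ * ‖g‖ := by
      have hpos : 0 < (ε ^ q)⁻¹ := inv_pos.2 (Real.rpow_pos_of_pos hε q)
      rw [abs_mul, abs_of_pos hpos]
      gcongr
    have h4 := abs_sub ((ε ^ q)⁻¹ * c) (∫ x in (0 : ℝ)..1, F0 x)
    rw [← hd] at h4
    linarith
  · intro x hx
    rw [perLift_coe]
    simp only [hF, hF0, hh]
    rw [intervalIntegral_coe_sub_const g c hx]
    ring

theorem exists_Lop_eq_toLp_norm_le {ε : ℝ} (hε : 0 < ε) (q : ℝ) :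
    ∃ C : ℝ, 0 ≤ C ∧ ∀ g : L2T, ∃ F : C(UnitAddCircle, ℝ),
      ContinuousMap.toLp 2 volume ℝ F = Lop hε q g ∧ ∀ x, |F x| ≤ C * ‖g‖ := by
  have hpos : 0 < (ε ^ q)⁻¹ := inv_pos.2 (Real.rpow_pos_of_pos hε q)
  -- One `‖g‖` for the primitive, one for the linear term, and `2 + ε^{-q}` for `d`.
  refine ⟨4 + (ε ^ q)⁻¹, by positivity, fun g => ?_⟩
  obtain ⟨F, d, hF, hd, hFx⟩ := exists_Lop_eq_toLp hε q g
  refine ⟨F, hF, fun y => ?_⟩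
  obtain ⟨x, hx, rfl⟩ : ∃ x ∈ Ico (0 : ℝ) (0 + 1), (x : UnitAddCircle) = y := by
    have := AddCircle.coe_image_Ico_eq (1 : ℝ) 0
    exact (this ▸ mem_univ y : y ∈ _)
  rw [zero_add] at hx
  have hx' := Ico_subset_Icc_self hx
  rw [hFx x hx']
  have h1 := abs_intervalIntegral_coe_le g hx'
  have h2 := abs_intervalIntegral_coe_le g (x := 1) (by simp)
  rw [integral_coe_eq] at h2
  have h3 : |(∫ y, g y) * x| ≤ ‖g‖ := by
    rw [abs_mul, abs_of_nonneg hx.1]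
    nlinarith [hx.2, abs_nonneg (∫ y, g y), hx.1]
  have h4 := abs_add_le ((∫ t in (0 : ℝ)..x, g (t : UnitAddCircle)) - (∫ y, g y) * x) d
  have h5 := abs_sub (∫ t in (0 : ℝ)..x, g (t : UnitAddCircle)) ((∫ y, g y) * x)
  linarith

/-- `L` is a Hilbert-Schmidt operator. -/
theorem exists_sum_norm_Lop_sq_le {ε : ℝ} (hε : 0 < ε) (q : ℝ) :
    ∃ C : ℝ, ∀ {ι : Type} (s : Finset ι) (e : ι → L2T), Orthonormal ℝ e →
      ∑ j ∈ s, ‖Lop hε q (e j)‖ ^ 2 ≤ C := by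
  obtain ⟨C, hC, hL⟩ := exists_Lop_eq_toLp_norm_le hε q
  choose Φ hΦ hΦb using hL
  refine ⟨C ^ 2, fun {ι} s e he => ?_⟩
  -- Fix `x` and apply the sup bound to `∑ a_j e_j` with `a_j = Φ (e_j) x`. Its image takes the
  -- value `S = ∑ a_j²` at `x` and its norm is `√S`, so `S ≤ C √S`, that is, `S ≤ C²`. Integrating
  -- over `x` gives the Hilbert-Schmidt bound.
  have hpt : ∀ x, ∑ j ∈ s, Φ (e j) x ^ 2 ≤ C ^ 2 := by
    intro x
    set a : ι → ℝ := fun j => Φ (e j) x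
    set S := ∑ j ∈ s, a j ^ 2 with hS
    -- The chosen representatives depend linearly on `g` here, because a continuous representative
    -- is unique.
    have hlin : Φ (∑ j ∈ s, a j • e j) = ∑ j ∈ s, a j • Φ (e j) := by
      apply ContinuousMap.toLp_injective (p := 2) (𝕜 := ℝ) (volume : Measure UnitAddCircle)
      rw [hΦ, map_sum, map_sum]
      simp_rw [map_smul, hΦ]
    have hnorm : ‖∑ j ∈ s, a j • e j‖ ^ 2 = S := by
      rw [← real_inner_self_eq_norm_sq, he.inner_sum]
      simp [hS, sq]
    have hval : Φ (∑ j ∈ s, a j • e j) x = S := by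
      rw [hlin]
      simp [a, hS, sq, ContinuousMap.coe_sum, Finset.sum_apply]
    have h1 := (le_abs_self _).trans (hΦb (∑ j ∈ s, a j • e j) x)
    rw [hval] at h1
    have hS0 : 0 ≤ S := Finset.sum_nonneg fun _ _ => sq_nonneg _
    by_contra hlt
    rw [not_le] at hlt
    set N := ‖∑ j ∈ s, a j • e j‖
    have hN : C < N := by
      refine lt_of_pow_lt_pow_left₀ 2 (norm_nonneg _) ?_
      rwa [hnorm]
    nlinarith
  have hn : ∀ g, ‖Lop hε q g‖ ^ 2 = ∫ x, Φ g x ^ 2 := by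
    intro g
    rw [← hΦ, ← real_inner_self_eq_norm_sq, ContinuousMap.inner_toLp]
    refine integral_congr_ae (Eventually.of_forall fun x => ?_)
    simp [sq]
  simp_rw [hn]
  have hint : ∀ g, Integrable (fun x => Φ g x ^ 2) (volume : Measure UnitAddCircle) := by
    intro g
    have : Continuous fun x => Φ g x ^ 2 := by fun_prop
    exact this.integrable_of_hasCompactSupport (HasCompactSupport.of_compactSpace _)
  rw [← integral_finsetSum _ fun j _ => hint (e j)]
  refine (integral_mono (integrable_finsetSum _ fun j _ => hint (e j)) (integrable_const (C ^ 2))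
    hpt).trans ?_
  simp

/-! ### Completeness of the images `D_q f_j` -/

/-- The arc `[0, a)` of the circle. -/
def arc (a : ℝ) : Set UnitAddCircle := {y | (AddCircle.equivIco 1 0 y : ℝ) < a}

theorem measurableSet_arc (a : ℝ) : MeasurableSet (arc a) := by
  have h : Measurable fun y : UnitAddCircle => ((AddCircle.measurableEquivIco 1 0 y : _) : ℝ) :=
    measurable_subtype_coe.comp (AddCircle.measurableEquivIco 1 0).measurable
  exact measurableSet_lt h measurable_const

theorem coe_mem_arc {a t : ℝ} (ht : t ∈ Ico (0 : ℝ) 1) : (t : UnitAddCircle) ∈ arc a ↔ t < a := by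
  have : t ∈ Ico (0 : ℝ) (0 + 1) := by simpa using ht
  rw [arc, mem_ofPred_eq, AddCircle.equivIco_coe_eq this]

theorem arc_inter (a b : ℝ) : arc a ∩ arc b = arc (min a b) := by
  ext y
  simp [arc]

theorem setIntegral_arc (f : UnitAddCircle → ℝ) {a : ℝ} (ha : a ∈ Icc (0 : ℝ) 1) :
    ∫ y in arc a, f y = ∫ t in (0 : ℝ)..a, f (t : UnitAddCircle) := by
  have h := UnitAddCircle.integral_preimage 0 ((arc a).indicator f)
  rw [integral_indicator (measurableSet_arc a), zero_add] at h
  rw [← h, intervalIntegral.integral_of_le ha.1, integral_Ioc_eq_integral_Ioo,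
    integral_Ioc_eq_integral_Ioo]
  have h2 : Ioo 0 a = Ioo (0 : ℝ) 1 ∩ Iio a := by
    rw [Ioo_inter_Iio, min_eq_right ha.2]
  rw [h2, ← setIntegral_indicator measurableSet_Iio]
  refine setIntegral_congr_fun measurableSet_Ioo fun t ht => ?_
  simp only [indicator, coe_mem_arc (Ioo_subset_Ico_self ht), mem_Iio]

/-- The indicator function of the arc `[0, a)`. -/
def arcInd (a : ℝ) : L2T :=
  indicatorConstLp 2 (measurableSet_arc a) (measure_ne_top volume _) (1 : ℝ)

theorem inner_arcInd (g : L2T) {a : ℝ} (ha : a ∈ Icc (0 : ℝ) 1) :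
    inner ℝ (arcInd a) g = ∫ t in (0 : ℝ)..a, g (t : UnitAddCircle) := by
  rw [arcInd, L2.inner_indicatorConstLp_one, setIntegral_arc _ ha]

theorem intervalIntegral_arcInd {a x : ℝ} (ha : a ∈ Icc (0 : ℝ) 1) (hx : x ∈ Icc (0 : ℝ) 1) :
    ∫ t in (0 : ℝ)..x, arcInd a (t : UnitAddCircle) = min x a := by
  have hm : min x a ∈ Icc (0 : ℝ) 1 := ⟨le_min hx.1 ha.1, (min_le_left _ _).trans hx.2⟩
  have h1 : ∫ y in arc x, arcInd a y = ∫ y in arc x, (arc a).indicator (fun _ => (1 : ℝ)) y :=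
    integral_congr_ae (ae_restrict_of_ae indicatorConstLp_coeFn)
  rw [← setIntegral_arc _ hx, h1, setIntegral_indicator (measurableSet_arc a), arc_inter,
    setIntegral_arc _ hm, intervalIntegral.integral_const]
  simp

/-- Up to a constant, `L` of the indicator of `[0, a)` is `min x a` minus a linear term, so on `[0,
1]` its slope changes only at the mesh point `a`. -/
theorem Lop_arcInd_mem_PL2 {ε : ℝ} (hε : 0 < ε) (q : ℝ) (n k : ℕ) (hk : k ≤ 2 ^ n) :
    Lop hε q (arcInd ((k : ℝ) / 2 ^ n)) ∈ PL2 n := by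
  have hN : (0 : ℝ) < 2 ^ n := by positivity
  set a : ℝ := (k : ℝ) / 2 ^ n with ha_def
  have ha : a ∈ Icc (0 : ℝ) 1 :=
    ⟨by positivity, (div_le_one hN).2 (by exact_mod_cast hk)⟩
  obtain ⟨F, d, hF, -, hFx⟩ := exists_Lop_eq_toLp hε q (arcInd a)
  refine ⟨F, fun j => ?_, hF⟩
  have hcell : ∀ t ∈ Ico ((j : ℝ) / 2 ^ n) (((j : ℝ) + 1) / 2 ^ n),
      t ∈ Icc (0 : ℝ) 1 := fun t ht =>
    ⟨le_trans (by positivity) ht.1,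
      ht.2.le.trans ((div_le_one hN).2 (by exact_mod_cast j.2))⟩
  rcases lt_or_ge (j : ℕ) k with hjk | hjk
  · refine ⟨1 - ∫ y, arcInd a y, d, fun t ht => ?_⟩
    have hta : t ≤ a := ht.2.le.trans (by
      rw [ha_def]
      gcongr
      exact_mod_cast hjk)
    rw [hFx t (hcell t ht), intervalIntegral_arcInd ha (hcell t ht), min_eq_left hta]
    ring
  · refine ⟨-∫ y, arcInd a y, a + d, fun t ht => ?_⟩
    have hta : a ≤ t := le_trans (by
      rw [ha_def]
      gcongr) ht.1
    rw [hFx t (hcell t ht), intervalIntegral_arcInd ha (hcell t ht), min_eq_right hta]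
    ring

/-- `L g` is piecewise linear, hence in the span of the `f_j`; applying `D_q` recovers `g`. -/
theorem arcInd_mem_span {ε q : ℝ} (hε : 0 < ε) {f : ℕ → H1} (hf : IsPLBasis ε q f) (n k : ℕ)
    (hn : 1 ≤ n) (hk : k ≤ 2 ^ n) :
    arcInd ((k : ℝ) / 2 ^ n) ∈ Submodule.span ℝ (range fun j => Dq ε q (f j)) := by
  set g := arcInd ((k : ℝ) / 2 ^ n)
  have h1 : Lop hε q g ∈ Submodule.span ℝ (range fun j : Fin (2 ^ n) => (f j : L2T)) := by
    rw [hf.span_eq n hn]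
    exact Lop_arcInd_mem_PL2 hε q n k hk
  have h2 : (range fun j : Fin (2 ^ n) => (f j : L2T)) =
      H1.subtype '' range fun j : Fin (2 ^ n) => f j := by
    rw [← range_comp]
    rfl
  rw [h2, ← Submodule.map_span] at h1
  obtain ⟨h, hh, hhg⟩ := h1
  have h3 : Dq ε q h = g := by
    have : h = (DqEquiv hε q).symm g := Subtype.ext hhg
    rw [this]
    exact (DqEquiv hε q).apply_symm_apply g
  rw [← h3]
  have h4 := Submodule.mem_map_of_mem (f := Dq ε q) hh
  rw [Submodule.map_span, ← range_comp] at h4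
  refine Submodule.span_mono ?_ h4
  rintro _ ⟨j, rfl⟩
  exact ⟨j, rfl⟩

/-- The primitive is continuous and vanishes at the dyadic points, hence on `[0, 1]`; Lebesgue
differentiation gives `g = 0` almost everywhere. -/
theorem eq_zero_of_forall_dyadic_integral_eq_zero (g : L2T)
    (hg : ∀ n k : ℕ, 1 ≤ n → k ≤ 2 ^ n →
      ∫ t in (0 : ℝ)..(k : ℝ) / 2 ^ n, g (t : UnitAddCircle) = 0) : g = 0 := by
  have hgp : Function.Periodic (fun x : ℝ => g (x : UnitAddCircle)) 1 := by
    intro x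
    simp
  have hi : ∀ a b, IntervalIntegrable (fun x : ℝ => g (x : UnitAddCircle)) volume a b :=
    fun a b => hgp.intervalIntegrable₀ one_ne_zero (intervalIntegrable_coe g) a b
  set G : ℝ → ℝ := fun x => ∫ t in (0 : ℝ)..x, g (t : UnitAddCircle)
  have hGc : Continuous G := intervalIntegral.continuous_primitive hi 0
  have hG : ∀ x ∈ Icc (0 : ℝ) 1, G x = 0 := by
    intro x hx
    have h1 : Tendsto (fun n : ℕ => ((⌊x * 2 ^ n⌋₊ : ℕ) : ℝ) / 2 ^ n) atTop (𝓝 x) :=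
      (tendsto_nat_floor_mul_div_atTop hx.1).comp
        (tendsto_pow_atTop_atTop_of_one_lt one_lt_two)
    refine tendsto_nhds_unique ((hGc.tendsto x).comp h1) (tendsto_const_nhds.congr' ?_)
    filter_upwards [eventually_ge_atTop 1] with n hn
    refine (hg n _ hn ?_).symm
    refine Nat.floor_le_of_le ?_
    push_cast
    exact mul_le_of_le_one_left (by positivity) hx.2
  have hae : ∀ᵐ x : ℝ, x ∈ Ioo (0 : ℝ) 1 → g (x : UnitAddCircle) = 0 := by
    filter_upwards [(hi 0 1).ae_hasDerivAt_integral] with x hx hmem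
    have hx' : x ∈ uIcc (0 : ℝ) 1 := by
      rw [uIcc_of_le zero_le_one]
      exact Ioo_subset_Icc_self hmem
    have h1 : HasDerivAt G (g (x : UnitAddCircle)) x := hx hx' 0 (by simp)
    have h2 : G =ᶠ[𝓝 x] fun _ => 0 := by
      filter_upwards [Ioo_mem_nhds hmem.1 hmem.2] with y hy
      exact hG y (Ioo_subset_Icc_self hy)
    exact h1.unique ((hasDerivAt_const x (0 : ℝ)).congr_of_eventuallyEq h2)
  refine eq_zero_of_forall_pair g fun φ _ _ => ?_
  rw [intervalIntegral.integral_of_le zero_le_one, integral_Ioc_eq_integral_Ioo]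
  rw [setIntegral_congr_ae (g := fun _ => (0 : ℝ)) measurableSet_Ioo]
  · simp
  · filter_upwards [hae] with x hx hmem
    rw [hx hmem, zero_mul]

/-- The vectors `D_q f_j` form a Hilbert basis of `L²(𝕋)`. -/
def hilbertBasisDq {ε q : ℝ} (hε : 0 < ε) {f : ℕ → H1} (hf : IsPLBasis ε q f) :
    HilbertBasis ℕ ℝ L2T :=
  HilbertBasis.mkOfOrthogonalEqBot hf.orthonormal (by
    rw [Submodule.eq_bot_iff]
    intro g hg
    refine eq_zero_of_forall_dyadic_integral_eq_zero g fun n k hn hk => ?_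
    have hN : (0 : ℝ) < 2 ^ n := by positivity
    rw [← inner_arcInd g ⟨by positivity, (div_le_one hN).2 (by exact_mod_cast hk)⟩]
    exact (Submodule.mem_orthogonal _ _).1 hg _ (arcInd_mem_span hε hf n k hn hk))

theorem hilbertBasisDq_apply {ε q : ℝ} (hε : 0 < ε) {f : ℕ → H1} (hf : IsPLBasis ε q f) (j : ℕ) :
    hilbertBasisDq hε hf j = Dq ε q (f j) := by
  simp [hilbertBasisDq]

/-- The squared norms of the images of a Hilbert basis under the adjoint of `L` are summable. -/
theorem summable_norm_adjoint_Lop_sq {ε : ℝ} (hε : 0 < ε) (q : ℝ) (b : HilbertBasis ℕ ℝ L2T) :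
    Summable fun i => ‖ContinuousLinearMap.adjoint (Lop hε q) (b i)‖ ^ 2 := by
  -- Expand `‖L* b_i‖² = ∑_j ⟨b_i, L b_j⟩²` and exchange the sums: Bessel in `i` leaves `∑_j ‖L
  -- b_j‖²`, bounded by `C`.
  obtain ⟨C, hC⟩ := exists_sum_norm_Lop_sq_le hε q
  have hsum : ∀ i, HasSum (fun j => inner ℝ (b i) (Lop hε q (b j)) ^ 2)
      (‖ContinuousLinearMap.adjoint (Lop hε q) (b i)‖ ^ 2) := by
    intro i
    rw [← real_inner_self_eq_norm_sq]
    refine (b.hasSum_inner_mul_inner _ _).congr_fun fun j => ?_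
    rw [real_inner_comm _ (b j), ContinuousLinearMap.adjoint_inner_left, sq]
  refine summable_of_sum_range_le (c := C) (fun _ => sq_nonneg _) fun m => ?_
  refine hasSum_le_of_sum_le (hasSum_sum fun i _ => hsum i) fun s => ?_
  refine le_trans (Finset.sum_le_sum fun j _ => ?_) (hC s b b.orthonormal)
  refine le_trans (le_of_eq ?_) (b.orthonormal.sum_inner_products_le (Lop hε q (b j))
    (s := Finset.range m))
  simp

/-! ### Convergence of the averaging operators `Q_n` -/

theorem mem_Ico_zero_one_of_mem_cell_Ico (n : ℕ) (j : Fin (2 ^ n)) {t : ℝ}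
    (ht : t ∈ Ico ((j : ℝ) / 2 ^ n) (((j : ℝ) + 1) / 2 ^ n)) : t ∈ Ico (0 : ℝ) 1 := by
  have hN : (0 : ℝ) < 2 ^ n := by positivity
  exact ⟨le_trans (by positivity) ht.1,
    ht.2.trans_le ((div_le_one hN).2 (by exact_mod_cast j.2))⟩

theorem mem_cell_iff (n : ℕ) (j : Fin (2 ^ n)) {t : ℝ} (ht : t ∈ Ico (0 : ℝ) 1) :
    (t : UnitAddCircle) ∈ cell n j ↔ t ∈ Ico ((j : ℝ) / 2 ^ n) (((j : ℝ) + 1) / 2 ^ n) := by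
  refine ⟨?_, fun h => ⟨t, h, rfl⟩⟩
  rintro ⟨s, hs, hst⟩
  have hs' := mem_Ico_zero_one_of_mem_cell_Ico n j hs
  rw [← zero_add (1 : ℝ)] at ht hs'
  rwa [← (AddCircle.coe_eq_coe_iff_of_mem_Ico hs' ht).1 hst]

theorem exists_coe_eq (y : UnitAddCircle) : ∃ t ∈ Ico (0 : ℝ) 1, (t : UnitAddCircle) = y := by
  have h := AddCircle.coe_image_Ico_eq (1 : ℝ) 0
  rw [zero_add] at h
  exact (h ▸ mem_univ y : y ∈ _)

theorem cell_eq_arc_diff (n : ℕ) (j : Fin (2 ^ n)) :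
    cell n j = arc (((j : ℝ) + 1) / 2 ^ n) \ arc ((j : ℝ) / 2 ^ n) := by
  ext y
  obtain ⟨t, ht, rfl⟩ := exists_coe_eq y
  rw [mem_cell_iff n j ht, Set.mem_sdiff, coe_mem_arc ht, coe_mem_arc ht, not_lt, and_comm]
  exact Iff.rfl

theorem measureReal_arc {a : ℝ} (ha : a ∈ Icc (0 : ℝ) 1) :
    volume.real (arc a : Set UnitAddCircle) = a := by
  have h := setIntegral_arc (fun _ => (1 : ℝ)) ha
  simpa using h

theorem measureReal_cell (n : ℕ) (j : Fin (2 ^ n)) : volume.real (cell n j) = (2 ^ n)⁻¹ := by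
  have hN : (0 : ℝ) < 2 ^ n := by positivity
  have hj : ((j : ℝ) + 1) / 2 ^ n ≤ 1 := (div_le_one hN).2 (by exact_mod_cast j.2)
  have hle : (j : ℝ) / 2 ^ n ≤ ((j : ℝ) + 1) / 2 ^ n := by gcongr; linarith
  have h0 : (0 : ℝ) ≤ (j : ℝ) / 2 ^ n := by positivity
  rw [cell_eq_arc_diff, measureReal_sdiff ?_ (measurableSet_arc _),
    measureReal_arc ⟨h0.trans hle, hj⟩, measureReal_arc ⟨h0, hle.trans hj⟩]
  · field_simp
    ring
  · intro y hy
    exact lt_of_lt_of_le hy hle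

theorem volume_cell (n : ℕ) (j : Fin (2 ^ n)) : volume (cell n j) = (2 ^ n)⁻¹ := by
  rw [← ENNReal.ofReal_toReal (measure_ne_top volume (cell n j)), ← measureReal_def,
    measureReal_cell, ENNReal.ofReal_inv_of_pos (by positivity)]
  simp [ENNReal.ofReal_pow]

theorem pairwise_disjoint_cell (n : ℕ) : Pairwise (Function.onFun Disjoint (cell n)) := by
  intro i j hij
  refine Set.disjoint_left.2 fun y hi hj => hij ?_
  obtain ⟨t, ht, rfl⟩ := exists_coe_eq y
  rw [mem_cell_iff n _ ht] at hi hj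
  have hN : (0 : ℝ) < 2 ^ n := by positivity
  have h1 : (i : ℝ) < j + 1 := (div_lt_div_iff_of_pos_right hN).1 (hi.1.trans_lt hj.2)
  have h2 : (j : ℝ) < i + 1 := (div_lt_div_iff_of_pos_right hN).1 (hj.1.trans_lt hi.2)
  have h3 : (i : ℕ) < j + 1 := by exact_mod_cast h1
  have h4 : (j : ℕ) < i + 1 := by exact_mod_cast h2
  exact Fin.ext (by omega)

theorem exists_mem_cell (n : ℕ) (y : UnitAddCircle) : ∃ j, y ∈ cell n j := by
  obtain ⟨t, ht, rfl⟩ := exists_coe_eq y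
  have hN : (0 : ℝ) < 2 ^ n := by positivity
  have h0 : 0 ≤ t * 2 ^ n := mul_nonneg ht.1 hN.le
  have hlt : ⌊t * 2 ^ n⌋₊ < 2 ^ n := by
    rw [Nat.floor_lt h0]
    push_cast
    nlinarith [ht.2]
  refine ⟨⟨_, hlt⟩, (mem_cell_iff n _ ht).2 ⟨?_, ?_⟩⟩
  · rw [div_le_iff₀ hN]
    exact Nat.floor_le h0
  · rw [lt_div_iff₀ hN]
    exact Nat.lt_floor_add_one _

theorem Qn_apply_of_mem_cell {n : ℕ} {j : Fin (2 ^ n)} (v : L2T) {y : UnitAddCircle}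
    (hy : y ∈ cell n j) : Qn n v y = 2 ^ n * ∫ z in cell n j, v z := by
  rw [Qn, Finset.sum_eq_single j]
  · simp [hy]
  · intro i _ hij
    rw [indicator_of_notMem, mul_zero]
    exact fun hi => Set.disjoint_left.1 (pairwise_disjoint_cell n hij) hi hy
  · simp

theorem integrable_coeFn (v : L2T) : Integrable v (volume : Measure UnitAddCircle) :=
  (Lp.memLp v).integrable (by norm_num)

theorem Qn_sub (n : ℕ) (u v : L2T) (y : UnitAddCircle) :
    Qn n (u - v) y = Qn n u y - Qn n v y := by
  obtain ⟨j, hj⟩ := exists_mem_cell n y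
  rw [Qn_apply_of_mem_cell _ hj, Qn_apply_of_mem_cell _ hj, Qn_apply_of_mem_cell _ hj, ← mul_sub,
    ← integral_sub (integrable_coeFn u).integrableOn (integrable_coeFn v).integrableOn]
  congr 1
  exact integral_congr_ae (ae_restrict_of_ae (Lp.coeFn_sub u v))

/-- Averaging contracts `L¹` because, on each cell, the modulus of the mean is at most the mean of
the modulus. -/
theorem eLpNorm_Qn_le (n : ℕ) (v : L2T) :
    eLpNorm (Qn n v) 1 (volume : Measure UnitAddCircle) ≤ eLpNorm v 1 volume := by
  have huniv : ⋃ j, cell n j = univ := eq_univ_of_forall fun y => mem_iUnion.2 (exists_mem_cell n y)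
  have hsplit : ∀ F : UnitAddCircle → ℝ≥0∞, ∫⁻ y, F y = ∑ j, ∫⁻ y in cell n j, F y := by
    intro F
    rw [← setLIntegral_univ F, ← huniv, lintegral_iUnion (measurableSet_cell n)
      (pairwise_disjoint_cell n), tsum_fintype]
  rw [eLpNorm_one_eq_lintegral_enorm, eLpNorm_one_eq_lintegral_enorm, hsplit, hsplit]
  refine Finset.sum_le_sum fun j _ => ?_
  have h1 : ∫⁻ y in cell n j, ‖Qn n v y‖ₑ =
      ∫⁻ _ in cell n j, ‖2 ^ n * ∫ z in cell n j, v z‖ₑ :=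
    setLIntegral_congr_fun (measurableSet_cell n j) fun y hy => by
      simp only [Qn_apply_of_mem_cell v hy]
  rw [h1, setLIntegral_const, volume_cell, enorm_mul, mul_right_comm]
  have h2 : ‖(2 : ℝ) ^ n‖ₑ * (2 ^ n)⁻¹ = 1 := by
    rw [Real.enorm_of_nonneg (by positivity), ENNReal.ofReal_pow (by norm_num)]
    simp only [ENNReal.ofReal_ofNat]
    exact ENNReal.mul_inv_cancel (by simp) (by simp)
  rw [h2, one_mul]
  exact enorm_integral_le_lintegral_enorm _

theorem dist_le_of_mem_cell {n : ℕ} {j : Fin (2 ^ n)} {y z : UnitAddCircle} (hy : y ∈ cell n j)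
    (hz : z ∈ cell n j) : dist y z ≤ (2 ^ n)⁻¹ := by
  obtain ⟨s, hs, rfl⟩ := hy
  obtain ⟨t, ht, rfl⟩ := hz
  have h1 : dist (s : UnitAddCircle) (t : UnitAddCircle) ≤ |s - t| := by
    rw [dist_eq_norm, ← AddCircle.coe_sub]
    exact QuotientAddGroup.norm_mk_le_norm
  refine h1.trans ?_
  have h2 : ((j : ℝ) + 1) / 2 ^ n = (j : ℝ) / 2 ^ n + (2 ^ n)⁻¹ := by
    field_simp
  rw [h2] at hs ht
  rw [abs_le]
  constructor <;> linarith [hs.1, hs.2, ht.1, ht.2]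

/-- Uniform continuity: `Q_n w` averages `w` over a cell of diameter at most `2⁻ⁿ`. -/
theorem eventually_abs_Qn_sub_le (w : C(UnitAddCircle, ℝ)) {δ : ℝ} (hδ : 0 < δ) :
    ∀ᶠ n in atTop, ∀ y, |Qn n (ContinuousMap.toLp 2 volume ℝ w) y - w y| ≤ δ := by
  obtain ⟨r, hr, hw⟩ := Metric.uniformContinuous_iff.1
    (CompactSpace.uniformContinuous_of_continuous w.continuous) δ hδ
  have h2 : Tendsto (fun n : ℕ => ((2 : ℝ) ^ n)⁻¹) atTop (𝓝 0) :=
    tendsto_inv_atTop_zero.comp (tendsto_pow_atTop_atTop_of_one_lt one_lt_two)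
  filter_upwards [h2.eventually (gt_mem_nhds hr)] with n hn y
  obtain ⟨j, hj⟩ := exists_mem_cell n y
  have hN : (0 : ℝ) < 2 ^ n := by positivity
  have hwi : Integrable w (volume : Measure UnitAddCircle) :=
    w.continuous.integrable_of_hasCompactSupport (HasCompactSupport.of_compactSpace _)
  have h3 : ∫ z in cell n j, (ContinuousMap.toLp 2 volume ℝ w : L2T) z = ∫ z in cell n j, w z :=
    integral_congr_ae (ae_restrict_of_ae (ContinuousMap.coeFn_toLp _ w))
  have h4 : 2 ^ n * (∫ z in cell n j, w z) - w y = 2 ^ n * ∫ z in cell n j, (w z - w y) := by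
    rw [integral_sub hwi.integrableOn (integrable_const _), setIntegral_const, measureReal_cell]
    field_simp
    simp
    field_simp
  rw [Qn_apply_of_mem_cell _ hj, h3, h4, abs_mul, abs_of_pos hN]
  have h5 : ‖∫ z in cell n j, (w z - w y)‖ ≤ δ * volume.real (cell n j) :=
    norm_setIntegral_le_of_norm_le_const (measure_lt_top _ _) fun z hz => by
      rw [← dist_eq_norm]
      exact (hw ((dist_le_of_mem_cell hz hj).trans_lt hn)).le
  rw [measureReal_cell, Real.norm_eq_abs] at h5
  calc 2 ^ n * |∫ z in cell n j, (w z - w y)| ≤ 2 ^ n * (δ * (2 ^ n)⁻¹) := by gcongr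
    _ = δ := by field_simp

theorem eLpNorm_one_le_enorm (u : L2T) :
    eLpNorm u 1 (volume : Measure UnitAddCircle) ≤ ‖u‖ₑ := by
  rw [Lp.enorm_def]
  exact eLpNorm_le_eLpNorm_of_exponent_le (by norm_num) (Lp.aestronglyMeasurable u)

theorem tendsto_eLpNorm_Qn_sub (v : L2T) :
    Tendsto (fun n => eLpNorm (fun y => Qn n v y - v y) 1 (volume : Measure UnitAddCircle))
      atTop (𝓝 0) := by
  rw [ENNReal.tendsto_nhds_zero]
  intro δ hδ
  have hδ3 : 0 < δ / 3 := ENNReal.div_pos hδ.ne' (by simp)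
  obtain ⟨w, hw⟩ := (ContinuousMap.toLp_denseRange ℝ (volume : Measure UnitAddCircle) (p := 2) ℝ
    (by norm_num)).exists_mem_open Metric.isOpen_eball ⟨v, Metric.mem_eball_self hδ3⟩
  set W : L2T := ContinuousMap.toLp 2 volume ℝ w with hW
  have h1 : ‖W - v‖ₑ < δ / 3 := by
    rw [← edist_eq_enorm_sub]
    exact hw
  obtain ⟨r, hr, hrδ⟩ : ∃ r : ℝ, 0 < r ∧ ENNReal.ofReal r ≤ δ / 3 := by
    obtain ⟨r, hr0, hr⟩ := ENNReal.lt_iff_exists_nnreal_btwn.1 hδ3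
    exact ⟨r, by exact_mod_cast hr0, by simpa using hr.le⟩
  filter_upwards [eventually_abs_Qn_sub_le w hr] with n hn
  have hWv : eLpNorm (W - v : L2T) 1 (volume : Measure UnitAddCircle) ≤ δ / 3 :=
    (eLpNorm_one_le_enorm _).trans h1.le
  have hmQ : ∀ u, AEStronglyMeasurable (Qn n u) (volume : Measure UnitAddCircle) :=
    fun u => (measurable_Qn n u).aestronglyMeasurable
  have hmw : AEStronglyMeasurable w (volume : Measure UnitAddCircle) :=
    w.continuous.aestronglyMeasurable
  -- Three-term splitting through a continuous `L²` approximant `w`; contractivity of `Q_n` controls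
  -- the middle term.
  have hsplit : (fun y => Qn n v y - v y) =ᵐ[volume]
      (fun y => Qn n W y - w y) - Qn n (W - v) + (W - v : L2T) := by
    filter_upwards [Lp.coeFn_sub W v, ContinuousMap.coeFn_toLp (E := ℝ) (p := 2) (𝕜 := ℝ)
      (volume : Measure UnitAddCircle) w] with y h2 h3
    simp only [Pi.add_apply, Pi.sub_apply, Qn_sub, h2]
    rw [show W y = w y from h3]
    ring
  rw [eLpNorm_congr_ae hsplit]
  have hu : eLpNorm (fun y => Qn n W y - w y) 1 (volume : Measure UnitAddCircle) ≤ δ / 3 := by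
    have := eLpNorm_le_of_ae_bound (p := 1) (μ := (volume : Measure UnitAddCircle))
      (f := fun y => Qn n W y - w y) (C := r) (Eventually.of_forall hn)
    simp only [measure_univ, ENNReal.one_rpow, one_mul] at this
    exact this.trans hrδ
  calc _ ≤ eLpNorm ((fun y => Qn n W y - w y) - Qn n (W - v)) 1 volume +
        eLpNorm (W - v : L2T) 1 volume :=
        eLpNorm_add_le (((hmQ W).sub hmw).sub (hmQ _)) (Lp.aestronglyMeasurable _) le_rfl
    _ ≤ (eLpNorm (fun y => Qn n W y - w y) 1 volume + eLpNorm (Qn n (W - v)) 1 volume) +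
        eLpNorm (W - v : L2T) 1 volume := by
        gcongr
        exact eLpNorm_sub_le ((hmQ W).sub hmw) (hmQ _) le_rfl
    _ ≤ (δ / 3 + δ / 3) + δ / 3 := by
        gcongr
        exact (eLpNorm_Qn_le n _).trans hWv
    _ = δ := ENNReal.add_thirds δ

/-- The circle has mass one, so `L¹ ≤ L^p`; the double integral only increases the Sobolev norm. -/
theorem eLpNorm_one_le_sobolevNorm {t p : ℝ} (hp : 1 < p) (u : L2T) :
    eLpNorm u 1 (volume : Measure UnitAddCircle) ≤ sobolevNorm t p u := by
  have hp0 : 0 < p := by linarith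
  have h1 : eLpNorm u 1 (volume : Measure UnitAddCircle) ≤ eLpNorm u (ENNReal.ofReal p) volume :=
    eLpNorm_le_eLpNorm_of_exponent_le (by simpa using hp.le) (Lp.aestronglyMeasurable u)
  refine h1.trans ?_
  rw [eLpNorm_eq_lintegral_rpow_enorm_toReal (by simpa using hp0) (by simp),
    ENNReal.toReal_ofReal hp0.le, sobolevNorm, one_div]
  gcongr
  exact le_self_add

theorem tendsto_eLpNorm_Qn_sub_of_sobolevNorm {t p : ℝ} (hp : 1 < p) {v : L2T} {vn : ℕ → L2T}
    (h : Tendsto (fun n => sobolevNorm t p (vn n - v : L2T)) atTop (𝓝 0)) :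
    Tendsto (fun n => eLpNorm (fun y => Qn n (vn n) y - v y) 1 (volume : Measure UnitAddCircle))
      atTop (𝓝 0) := by
  have h1 : Tendsto (fun n => sobolevNorm t p (vn n - v : L2T) +
      eLpNorm (fun y => Qn n v y - v y) 1 (volume : Measure UnitAddCircle)) atTop (𝓝 0) := by
    simpa using h.add (tendsto_eLpNorm_Qn_sub v)
  refine tendsto_of_tendsto_of_tendsto_of_le_of_le tendsto_const_nhds h1 (fun _ => zero_le)
    fun n => ?_
  -- The moving argument costs only `Q_n (v_n - v)`, which the contraction bounds.
  have h2 : (fun y => Qn n (vn n) y - v y) =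
      Qn n (vn n - v) + fun y => Qn n v y - v y := by
    ext y
    simp only [Pi.add_apply, Qn_sub]
    ring
  simp only [h2]
  refine (eLpNorm_add_le (measurable_Qn n _).aestronglyMeasurable
    ((measurable_Qn n v).aestronglyMeasurable.sub (Lp.aestronglyMeasurable v)) le_rfl).trans ?_
  exact add_le_add ((eLpNorm_Qn_le n _).trans (eLpNorm_one_le_sobolevNorm hp _)) le_rfl

/-! ### Multiplication operators -/

theorem coeFn_mulOp (m : UnitAddCircle → ℝ) (hm : MemLp m ∞ volume) (g : L2T) :
    mulOp m hm g =ᵐ[volume] fun x => m x * g x := by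
  rw [mulOp, ContinuousLinearMap.holderL_apply_apply]
  filter_upwards [ContinuousLinearMap.coeFn_holder (r := 2) (ContinuousLinearMap.mul ℝ ℝ)
    (hm.toLp m) g, hm.coeFn_toLp] with x h1 h2
  rw [h1, h2]
  rfl

theorem inner_mulOp (m : UnitAddCircle → ℝ) (hm : MemLp m ∞ volume) (g h : L2T) :
    inner ℝ (mulOp m hm g) h = ∫ x, m x * (g x * h x) := by
  rw [L2.inner_def]
  refine integral_congr_ae ?_
  filter_upwards [coeFn_mulOp m hm g] with x hx
  rw [hx]
  simp only [RCLike.inner_apply, conj_trivial]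
  ring

theorem norm_mulOp_le (m : UnitAddCircle → ℝ) (hm : MemLp m ∞ volume) {C : ℝ}
    (hC : ∀ x, |m x| ≤ C) (g : L2T) : ‖mulOp m hm g‖ ≤ C * ‖g‖ := by
  refine Lp.norm_le_mul_norm_of_ae_le_mul ?_
  filter_upwards [coeFn_mulOp m hm g] with x hx
  rw [hx, norm_mul]
  gcongr
  exact hC x

theorem abs_inv_add_sq_le {ε : ℝ} (hε : 0 < ε) (s : ℝ) : |(ε ^ 2 + s ^ 2)⁻¹| ≤ (ε ^ 2)⁻¹ := by
  rw [abs_of_nonneg (by positivity)]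
  gcongr
  nlinarith [sq_nonneg s]

theorem tendsto_inner_mulOp {ε : ℝ} (hε : 0 < ε) {V : ℕ → UnitAddCircle → ℝ}
    (hV : ∀ n, AEStronglyMeasurable (V n) volume) (v : L2T)
    (h : Tendsto (fun n => eLpNorm (fun y => V n y - v y) 1 (volume : Measure UnitAddCircle))
      atTop (𝓝 0)) (g : L2T) :
    Tendsto (fun n => inner ℝ (mulOp (fun x => (ε ^ 2 + V n x ^ 2)⁻¹) (memLp_inv hε (hV n)) g) g)
      atTop (𝓝 (inner ℝ (Lam hε v g) g)) := by
  have hmeas : TendstoInMeasure volume V atTop v :=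
    tendstoInMeasure_of_tendsto_eLpNorm one_ne_zero hV (Lp.aestronglyMeasurable v) h
  have hg2 : Integrable (fun x => g x * g x) (volume : Measure UnitAddCircle) := by
    simpa [sq] using (Lp.memLp g).integrable_sq
  -- Convergence in measure gives almost everywhere convergence only along subsequences, which
  -- suffices for a sequence of real numbers. The dominating function is `ε⁻² g²`.
  refine tendsto_of_subseq_tendsto fun ns hns => ?_
  obtain ⟨ms, -, hms⟩ :=
    TendstoInMeasure.exists_seq_tendsto_ae (f := fun k => V (ns k)) (hmeas.comp hns)
  refine ⟨ms, ?_⟩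
  simp only [Lam, inner_mulOp]
  refine tendsto_integral_of_dominated_convergence (fun x => (ε ^ 2)⁻¹ * (g x * g x)) ?_
    (hg2.const_mul _) ?_ ?_
  · exact fun n => (memLp_inv hε (hV _)).1.mul hg2.1
  · refine fun n => Eventually.of_forall fun x => ?_
    rw [norm_mul, Real.norm_of_nonneg (mul_self_nonneg (g x))]
    exact mul_le_mul_of_nonneg_right (abs_inv_add_sq_le hε _) (mul_self_nonneg _)
  · filter_upwards [hms] with x hx
    refine Tendsto.mul_const _ (Tendsto.inv₀ ((hx.pow 2).const_add _) ?_)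
    positivity

theorem tendsto_inner_LamN {ε : ℝ} (hε : 0 < ε) {v : L2T} {vn : ℕ → L2T}
    (h : Tendsto (fun n => eLpNorm (fun y => Qn n (vn n) y - v y) 1
      (volume : Measure UnitAddCircle)) atTop (𝓝 0)) {g : L2T} {gn : ℕ → L2T}
    (hg : Tendsto gn atTop (𝓝 g)) :
    Tendsto (fun n => inner ℝ (LamN hε n (vn n) (gn n)) (gn n)) atTop
      (𝓝 (inner ℝ (Lam hε v g) g)) := by
  have hb : ∀ n u, ‖LamN hε n (vn n) u‖ ≤ (ε ^ 2)⁻¹ * ‖u‖ := fun n u =>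
    norm_mulOp_le _ _ (fun x => abs_inv_add_sq_le hε _) u
  have h1 := tendsto_inner_mulOp hε (fun n => (measurable_Qn n (vn n)).aestronglyMeasurable) v h g
  have hd : Tendsto (fun n => ‖gn n - g‖) atTop (𝓝 0) := tendsto_iff_norm_sub_tendsto_zero.1 hg
  -- Replacing `gn n` by its limit costs two terms, both small because the operators are bounded by
  -- `ε⁻²` uniformly in `n`.
  have h2 : Tendsto (fun n => inner ℝ (LamN hε n (vn n) (gn n - g)) (gn n) +
      inner ℝ (LamN hε n (vn n) g) (gn n - g)) atTop (𝓝 0) := by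
    refine squeeze_zero_norm
      (a := fun n => (ε ^ 2)⁻¹ * ‖gn n - g‖ * ‖gn n‖ + (ε ^ 2)⁻¹ * ‖g‖ * ‖gn n - g‖)
      (fun n => ?_) ?_
    · refine (norm_add_le _ _).trans (add_le_add ?_ ?_)
      · refine (norm_inner_le_norm _ _).trans ?_
        gcongr
        exact hb n _
      · refine (norm_inner_le_norm _ _).trans ?_
        gcongr
        exact hb n _
    · simpa using ((hd.const_mul (ε ^ 2)⁻¹).mul hg.norm).add (hd.const_mul ((ε ^ 2)⁻¹ * ‖g‖))
  have h3 := h1.add h2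
  rw [add_zero] at h3
  refine h3.congr fun n => ?_
  change inner ℝ (LamN hε n (vn n) g) g + _ = _
  rw [map_sub, inner_sub_left, inner_sub_right ((LamN hε n (vn n)) g)]
  ring

/-! ### The discretised laws -/

theorem inner_mulOp_comm (m : UnitAddCircle → ℝ) (hm : MemLp m ∞ volume) (g h : L2T) :
    inner ℝ (mulOp m hm g) h = inner ℝ (mulOp m hm h) g := by
  simp_rw [inner_mulOp, mul_comm (g _)]

theorem inner_mulOp_self_nonneg {m : UnitAddCircle → ℝ} (hm : MemLp m ∞ volume)
    (h0 : ∀ x, 0 ≤ m x) (g : L2T) : 0 ≤ inner ℝ (mulOp m hm g) g := by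
  rw [inner_mulOp]
  exact integral_nonneg fun x => mul_nonneg (h0 x) (mul_self_nonneg _)

/-- This form of the quadratic form yields both positive semidefiniteness of `𝐂` and the variance of
the law. -/
theorem dotProduct_covMatrix {ε : ℝ} (hε : 0 < ε) (q : ℝ) (f : ℕ → H1) (n : ℕ) (v : L2T)
    (a : Fin (2 ^ n) → ℝ) :
    a ⬝ᵥ (covMatrix hε q f n v).mulVec a =
      inner ℝ (LamN hε n v (∑ j, a j • Dq ε q (f j))) (∑ j, a j • Dq ε q (f j)) := by
  rw [map_sum, sum_inner]
  simp_rw [inner_sum, map_smul, inner_smul_left, inner_smul_right, dotProduct, Matrix.mulVec,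
    dotProduct, covMatrix, Matrix.of_apply, Finset.mul_sum]
  refine Finset.sum_congr rfl fun i _ => Finset.sum_congr rfl fun j _ => ?_
  simp only [conj_trivial]
  ring

theorem posSemidef_covMatrix {ε : ℝ} (hε : 0 < ε) (q : ℝ) (f : ℕ → H1) (n : ℕ) (v : L2T) :
    (covMatrix hε q f n v).PosSemidef := by
  refine Matrix.PosSemidef.of_dotProduct_mulVec_nonneg ?_ fun a => ?_
  · ext i j
    exact inner_mulOp_comm _ _ _ _
  · rw [star_trivial, dotProduct_covMatrix]
    exact inner_mulOp_self_nonneg _ (fun x => by positivity) _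

/-- The synthesis map `u ↦ ∑ u_j f_j`. -/
def synth (f : ℕ → H1) (n : ℕ) : EuclideanSpace ℝ (Fin (2 ^ n)) →L[ℝ] L2T :=
  ∑ j, (EuclideanSpace.proj j).smulRight (f j : L2T)

theorem synth_apply (f : ℕ → H1) (n : ℕ) (u : EuclideanSpace ℝ (Fin (2 ^ n))) :
    synth f n u = ∑ j, u j • (f j : L2T) := by
  simp [synth]

theorem lamN_eq_map {ε : ℝ} (hε : 0 < ε) (q : ℝ) (f : ℕ → H1) (n : ℕ) (v : L2T) :
    lamN hε q f n v = (multivariateGaussian 0 (covMatrix hε q f n v)).map (synth f n) := by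
  rw [lamN]
  congr 1
  ext1 u
  rw [synth_apply]

instance isProbabilityMeasure_lamN {ε : ℝ} (hε : 0 < ε) (q : ℝ) (f : ℕ → H1) (n : ℕ) (v : L2T) :
    IsProbabilityMeasure (lamN hε q f n v) := by
  rw [lamN_eq_map]
  exact Measure.isProbabilityMeasure_map (synth f n).continuous.aemeasurable

/-- The covariance form of `λ_n^v`. -/
def covForm {ε : ℝ} (hε : 0 < ε) (q : ℝ) (f : ℕ → H1) (n : ℕ) (v φ : L2T) : ℝ :=
  inner ℝ
    (LamN hε n v (partialSum (fun j => Dq ε q (f j)) (2 ^ n)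
      (ContinuousLinearMap.adjoint (Lop hε q) φ)))
    (partialSum (fun j => Dq ε q (f j)) (2 ^ n) (ContinuousLinearMap.adjoint (Lop hε q) φ))

/-- The coordinates of the functional `φ` composed with the synthesis map. -/
def coords (f : ℕ → H1) (n : ℕ) (φ : L2T) : EuclideanSpace ℝ (Fin (2 ^ n)) :=
  WithLp.toLp 2 fun j => inner ℝ (f j : L2T) φ

theorem inner_synth (f : ℕ → H1) (n : ℕ) (φ : L2T) (u : EuclideanSpace ℝ (Fin (2 ^ n))) :
    inner ℝ (synth f n u) φ = inner ℝ u (coords f n φ) := by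
  rw [synth_apply, sum_inner, PiLp.inner_apply]
  refine Finset.sum_congr rfl fun j _ => ?_
  rw [inner_smul_left]
  simp [coords, mul_comm]

/-- From `f_j = L D_q f_j`, the coordinates of `φ` are the Fourier coefficients of `L* φ` along the
`D_q f_j`, so their combination is a partial sum of `L* φ`. -/
theorem coords_covMatrix {ε : ℝ} (hε : 0 < ε) (q : ℝ) (f : ℕ → H1) (n : ℕ) (v φ : L2T) :
    coords f n φ ⬝ᵥ (covMatrix hε q f n v).mulVec (coords f n φ) = covForm hε q f n v φ := by
  rw [dotProduct_covMatrix, covForm, partialSum_apply, Finset.sum_range]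
  have h : ∀ j : Fin (2 ^ n), coords f n φ j =
      inner ℝ (Dq ε q (f j)) (ContinuousLinearMap.adjoint (Lop hε q) φ) := by
    intro j
    rw [ContinuousLinearMap.adjoint_inner_right, Lop_Dq]
    rfl
  simp_rw [h]

theorem charFun_lamN {ε : ℝ} (hε : 0 < ε) (q : ℝ) (f : ℕ → H1) (n : ℕ) (v φ : L2T) :
    charFun (lamN hε q f n v) φ = Complex.exp (-(covForm hε q f n v φ : ℂ) / 2) := by
  have h1 : charFun (lamN hε q f n v) φ =
      charFun (multivariateGaussian 0 (covMatrix hε q f n v)) (coords f n φ) := by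
    rw [charFun_apply, charFun_apply, lamN_eq_map,
      integral_map (synth f n).continuous.aemeasurable (by fun_prop)]
    simp_rw [inner_synth]
  rw [h1, charFun_multivariateGaussian (posSemidef_covMatrix hε q f n v), coords_covMatrix,
    inner_zero_right]
  congr 1
  push_cast
  ring

theorem lintegral_enorm_inner_sq_lamN {ε : ℝ} (hε : 0 < ε) (q : ℝ) (f : ℕ → H1) (n : ℕ)
    (v φ : L2T) :
    ∫⁻ u, ‖inner ℝ φ u‖ₑ ^ 2 ∂(lamN hε q f n v) = ENNReal.ofReal (covForm hε q f n v φ) := by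
  have hc : Continuous fun u : L2T => inner ℝ φ u := by fun_prop
  rw [lamN_eq_map, lintegral_map (hc.measurable.enorm.pow_const 2) (synth f n).continuous.measurable]
  set γ := multivariateGaussian 0 (covMatrix hε q f n v)
  set a := coords f n φ with ha
  have hmem : MemLp id 2 γ := IsGaussian.memLp_two_id
  have h1 := covarianceBilin_multivariateGaussian (μ := 0) (posSemidef_covMatrix hε q f n v) a a
  have hm : ∫ x, id x ∂γ = 0 := integral_id_multivariateGaussian
  rw [coords_covMatrix, covarianceBilin_apply hmem, hm] at h1
  have hint : Integrable (fun z => inner ℝ a z * inner ℝ a z) γ := by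
    simpa [sq] using (hmem.const_inner (𝕜 := ℝ) a).integrable_sq
  simp only [sub_zero] at h1
  rw [← h1, ofReal_integral_eq_lintegral_ofReal hint
    (Eventually.of_forall fun z => mul_self_nonneg _)]
  refine lintegral_congr fun u => ?_
  rw [real_inner_comm, inner_synth, real_inner_comm, ← ha, sq, ← enorm_mul,
    Real.enorm_of_nonneg (mul_self_nonneg _)]

theorem norm_partialSum_le {H : Type*} [NormedAddCommGroup H] [InnerProductSpace ℝ H]
    {b : ℕ → H} (hb : Orthonormal ℝ b) (m : ℕ) (u : H) : ‖partialSum b m u‖ ≤ ‖u‖ := by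
  refine le_of_sq_le_sq ?_ (norm_nonneg u)
  rw [← real_inner_self_eq_norm_sq, partialSum_apply, hb.inner_sum]
  refine le_trans (le_of_eq ?_) (hb.sum_inner_products_le u (s := Finset.range m))
  simp [sq]

/-- The bound depends on neither `n` nor `v`, which is the uniformity that tightness requires. -/
theorem covForm_le {ε q : ℝ} (hε : 0 < ε) {f : ℕ → H1} (hf : IsPLBasis ε q f) (n : ℕ)
    (v φ : L2T) :
    covForm hε q f n v φ ≤ (ε ^ 2)⁻¹ * ‖ContinuousLinearMap.adjoint (Lop hε q) φ‖ ^ 2 := by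
  set ψ := ContinuousLinearMap.adjoint (Lop hε q) φ with hψ
  have h1 := norm_partialSum_le hf.orthonormal (2 ^ n) ψ
  refine (real_inner_le_norm _ _).trans ?_
  rw [← hψ, sq ‖ψ‖, ← mul_assoc]
  have h2 : ‖LamN hε n v (partialSum (fun j => Dq ε q (f j)) (2 ^ n) ψ)‖ ≤ (ε ^ 2)⁻¹ * ‖ψ‖ :=
    (norm_mulOp_le _ _ (fun x => abs_inv_add_sq_le hε _) _).trans (by gcongr)
  gcongr

theorem isTightMeasureSet_lamN {ε q : ℝ} (hε : 0 < ε) {f : ℕ → H1} (hf : IsPLBasis ε q f)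
    (vn : ℕ → L2T) : IsTightMeasureSet {x | ∃ n, lamN hε q f n (vn n) = x} := by
  set b := hilbertBasisDq hε hf
  have hs := (summable_norm_adjoint_Lop_sq hε q b).mul_left (ε ^ 2)⁻¹
  refine isTightMeasureSet_of_second_moment_le b _ (fun i => ENNReal.ofReal
    ((ε ^ 2)⁻¹ * ‖ContinuousLinearMap.adjoint (Lop hε q) (b i)‖ ^ 2)) hs.tsum_ofReal_ne_top ?_
  rintro _ ⟨n, rfl⟩ i
  rw [lintegral_enorm_inner_sq_lamN]
  exact ENNReal.ofReal_le_ofReal (covForm_le hε hf n _ _)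

theorem tendsto_partialSum {H : Type*} [NormedAddCommGroup H] [InnerProductSpace ℝ H]
    (b : HilbertBasis ℕ ℝ H) (u : H) : Tendsto (fun m => partialSum b m u) atTop (𝓝 u) := by
  simp_rw [partialSum_apply, ← b.repr_apply_apply]
  exact (b.hasSum_repr u).tendsto_sum_nat

theorem inner_CU {ε : ℝ} (hε : 0 < ε) (q : ℝ) (v φ ψ : L2T) :
    inner ℝ (CU hε q v φ) ψ = inner ℝ (Lam hε v (ContinuousLinearMap.adjoint (Lop hε q) φ))
      (ContinuousLinearMap.adjoint (Lop hε q) ψ) := by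
  rw [ContinuousLinearMap.adjoint_inner_right]
  rfl

theorem tendsto_covForm {ε q t p : ℝ} (hε : 0 < ε) {f : ℕ → H1} (hf : IsPLBasis ε q f)
    (hp : 1 < p) {v : L2T} {vn : ℕ → L2T}
    (h : Tendsto (fun n => sobolevNorm t p (vn n - v : L2T)) atTop (𝓝 0)) (φ : L2T) :
    Tendsto (fun n => covForm hε q f n (vn n) φ) atTop (𝓝 (inner ℝ (CU hε q v φ) φ)) := by
  rw [inner_CU]
  refine tendsto_inner_LamN hε (tendsto_eLpNorm_Qn_sub_of_sobolevNorm hp h) ?_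
  -- Completeness of the `D_q f_j` makes the partial sums converge, in particular along the indices
  -- `2 ^ n`.
  have h1 := (tendsto_partialSum (hilbertBasisDq hε hf)
    (ContinuousLinearMap.adjoint (Lop hε q) φ)).comp
    (tendsto_pow_atTop_atTop_of_one_lt (one_lt_two (α := ℕ)))
  have h2 : (hilbertBasisDq hε hf : ℕ → L2T) = fun j => Dq ε q (f j) :=
    funext (hilbertBasisDq_apply hε hf)
  rwa [h2] at h1

/-! ### The limit law -/

theorem IsCenteredGaussian.covarianceBilin_eq {μ : Measure L2T} {C : L2T →L[ℝ] L2T}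
    (h : IsCenteredGaussian μ C) (φ ψ : L2T) : covarianceBilin μ φ ψ = inner ℝ (C φ) ψ := by
  have := h.isGaussian
  have hm : ∫ x, id x ∂μ = 0 := h.integral_eq_zero
  rw [covarianceBilin_apply IsGaussian.memLp_two_id, hm, ← h.covariance φ ψ]
  simp_rw [sub_zero, real_inner_comm]

theorem IsCenteredGaussian.charFun_eq {μ : Measure L2T} {C : L2T →L[ℝ] L2T}
    (h : IsCenteredGaussian μ C) (φ : L2T) :
    charFun μ φ = Complex.exp (-((inner ℝ (C φ) φ : ℝ) : ℂ) / 2) := by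
  have := h.isGaussian
  have hm : ∫ x, id x ∂μ = 0 := h.integral_eq_zero
  rw [IsGaussian.charFun_eq', hm, h.covarianceBilin_eq, inner_zero_right]
  congr 1
  push_cast
  ring

theorem IsCenteredGaussian.unique {μ ν : Measure L2T} {C : L2T →L[ℝ] L2T}
    (hμ : IsCenteredGaussian μ C) (hν : IsCenteredGaussian ν C) : μ = ν := by
  have := hμ.isGaussian
  have := hν.isGaussian
  refine Measure.ext_of_charFun (funext fun φ => ?_)
  rw [hμ.charFun_eq, hν.charFun_eq]

/-- Symmetry and positivity make `C` an admissible covariance form; uniqueness of the parameters of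
a Gaussian characteristic function then identifies mean and covariance. -/
theorem isCenteredGaussian_of_charFun {μ : Measure L2T} [IsFiniteMeasure μ] {C : L2T →L[ℝ] L2T}
    (hsymm : ∀ φ ψ, inner ℝ (C φ) ψ = inner ℝ (C ψ) φ) (hpos : ∀ φ, 0 ≤ inner ℝ (C φ) φ)
    (h : ∀ φ, charFun μ φ = Complex.exp (-((inner ℝ (C φ) φ : ℝ) : ℂ) / 2)) :
    IsCenteredGaussian μ C := by
  set F : L2T →L[ℝ] L2T →L[ℝ] ℝ := (innerSL ℝ).comp C
  have hF : F.toBilinForm.IsPosSemidef := ⟨⟨fun φ ψ => hsymm φ ψ⟩, ⟨fun φ => hpos φ⟩⟩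
  have hchar : ∀ φ, charFun μ φ =
      Complex.exp (((inner ℝ φ (0 : L2T) : ℝ) : ℂ) * Complex.I - ((F φ φ : ℝ) : ℂ) / 2) := by
    intro φ
    rw [h φ, inner_zero_right]
    change _ = Complex.exp (((0 : ℝ) : ℂ) * Complex.I - ((inner ℝ (C φ) φ : ℝ) : ℂ) / 2)
    congr 1
    push_cast
    ring
  have hG : IsGaussian μ := isGaussian_iff_gaussian_charFun.2 ⟨0, F, hF, hchar⟩
  obtain ⟨hm, hcov⟩ := gaussian_charFun_congr 0 F hF hchar
  refine ⟨hG, hm.symm, fun φ ψ => ?_⟩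
  have h1 : covarianceBilin μ φ ψ = inner ℝ (C φ) ψ := by
    rw [← hcov]
    rfl
  have hm' : ∫ x, id x ∂μ = 0 := hm.symm
  rw [covarianceBilin_apply IsGaussian.memLp_two_id, hm'] at h1
  rw [← h1]
  simp_rw [sub_zero, real_inner_comm]

end HierPrior

end

/-! ### Assembly: existence and uniqueness of the limit law, and weak convergence. -/

theorem lemma5p4 (ε q t₀ p₀ : ℝ) (hε : 0 < ε) (hq : 1 < q)
    (ht₀ : 0 < t₀) (ht₀' : t₀ < 1 / 2) (hp₀ : 1 < p₀)
    (f : ℕ → HierPrior.H1) (hf : HierPrior.IsPLBasis ε q f)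
    (v : HierPrior.L2T) (hv : HierPrior.sobolevNorm t₀ p₀ v < ⊤)
    (vn : ℕ → HierPrior.L2T) (hvn : ∀ n, 1 ≤ n → vn n ∈ HierPrior.PL2 n)
    (hconv : Tendsto (fun n => HierPrior.sobolevNorm t₀ p₀ (vn n - v : HierPrior.L2T))
      atTop (𝓝 0)) :
    (∃! μ : Measure HierPrior.L2T, HierPrior.IsCenteredGaussian μ (HierPrior.CU hε q v)) ∧
    ∀ μ : Measure HierPrior.L2T, HierPrior.IsCenteredGaussian μ (HierPrior.CU hε q v) →
      ∀ g : BoundedContinuousFunction HierPrior.L2T ℝ,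
        Tendsto (fun n => ∫ u, g u ∂(HierPrior.lamN hε q f n (vn n))) atTop
          (𝓝 (∫ u, g u ∂μ)) := by
  let μs : ℕ → ProbabilityMeasure HierPrior.L2T := fun n =>
    ⟨HierPrior.lamN hε q f n (vn n), inferInstance⟩
  obtain ⟨ν, hν, hchar⟩ :=
    HierPrior.exists_tendsto_of_isTightMeasureSet_of_tendsto_charFun μs
      (HierPrior.isTightMeasureSet_lamN hε hf vn)
      (fun φ => Complex.exp (-((inner ℝ (HierPrior.CU hε q v φ) φ : ℝ) : ℂ) / 2)) (fun φ => by
        have h1 : ∀ n, charFun (μs n : Measure HierPrior.L2T) φ =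
            Complex.exp (-(HierPrior.covForm hε q f n (vn n) φ : ℂ) / 2) :=
          fun n => HierPrior.charFun_lamN hε q f n (vn n) φ
        simp_rw [h1]
        have hc : Continuous fun s : ℝ => Complex.exp (-(s : ℂ) / 2) := by fun_prop
        exact (hc.tendsto _).comp (HierPrior.tendsto_covForm hε hf hp₀ hconv φ))
  -- The weak limit itself witnesses existence of the Gaussian with covariance `C_U(v)`.
  have hG : HierPrior.IsCenteredGaussian (ν : Measure HierPrior.L2T) (HierPrior.CU hε q v) := by
    refine HierPrior.isCenteredGaussian_of_charFun (fun φ ψ => ?_) (fun φ => ?_) hchar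
    · rw [HierPrior.inner_CU, HierPrior.inner_CU]
      exact HierPrior.inner_mulOp_comm _ _ _ _
    · rw [HierPrior.inner_CU]
      exact HierPrior.inner_mulOp_self_nonneg _ (fun x => by positivity) _
  refine ⟨⟨ν, hG, fun μ hμ => hμ.unique hG⟩, fun μ hμ g => ?_⟩
  rw [hμ.unique hG]
  exact ProbabilityMeasure.tendsto_iff_forall_integral_tendsto.1 hν g
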